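/- Let $\alpha>0$ and let $\mathbb T=\mathbb R/2\pi\mathbb Z$. On $\{(x,y)\in\mathbb R\times\mathbb T : x\neq 0\}$ consider the Riemannian metric $g$ for which the vector fields $X=(1,0)$ and $Y=(0,|x|^{\alpha})$ form an orthonormal frame. Let $d\omega=\sqrt{\det g}\,dx\,dy=|x|^{-\alpha}\,dx\,dy$ be its area and $\Delta=\operatorname{div}_{\omega}\nabla$ its Laplace–Beltrami operator, where $\nabla u=X(u)X+Y(u)Y$. Then: 1. For every smooth $u$ on $\{x\ne0\}$, $$\Delta u=\partial_x^2u+|x|^{2\alpha}\partial_y^2u-\frac{\alpha}{x}\,\partial_xu .$$ 2. The map $v\mapsto |x|^{\alpha/2}v$ is unitary from $L^2(\mathbb R\times\mathbb T,dx\,dy)$ onto $L^2(\mathbb R\times\mathbb T,d\omega)$, and it is a unitary equivalence between the operator $$\widetilde\Delta v=\partial_x^2v-\frac{\alpha}{2}\Big(\frac{\alpha}{2}+1\Big)\frac{1}{x^2}\,v+|x|^{2\alpha}\partial_y^2v$$ in $L^2(dx\,dy)$ with domain $C_0^\infty(\{x\neq0\})$ and the operator $\Delta$ in $L^2(d\omega)$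 with domain $C_0^\infty(\{x\neq0\})$ (it maps the first domain onto the second and intertwines the operators). Here $C_0^\infty(\{x\neq 0\})$ denotes the complex-valued smooth functions with compact support in $\{x\ne0\}\subset\mathbb R\times\mathbb T$. 3. $\widetilde\Delta$ is essentially self-adjoint (i.e. its closure is self-adjoint) if and only if $\alpha\ge1$, and likewise $\Delta$ is essentially self-adjoint if and only if $\alpha\ge 1$. In particular, neither is essentially self-adjoint for $\alpha\in(0,1)$. -/

import Mathlib

open MeasureTheory
open scoped ContDiff

noncomputable section

namespace AlphaGrushin

instance fact_two_pi_pos : Fact (0 < 2 * Real.pi) := ⟨Real.two_pi_pos⟩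

/-- The cylinder `ℝ × 𝕋`, where `𝕋 = ℝ / 2πℤ`. -/
abbrev Cyl : Type := ℝ × AddCircle (2 * Real.pi)

/-- The covering map `ℝ² → ℝ × 𝕋`. -/
def cover (q : ℝ × ℝ) : Cyl := (q.1, (q.2 : AddCircle (2 * Real.pi)))

/-- The partial derivative `∂_x` of a function on the cylinder. -/
def dx (f : Cyl → ℂ) (p : Cyl) : ℂ := deriv (fun s : ℝ => f (s, p.2)) p.1

/-- The partial derivative `∂_y` of a function on the cylinder. -/
def dy (f : Cyl → ℂ) (p : Cyl) : ℂ :=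
  deriv (fun t : ℝ => f (p.1, p.2 + (t : AddCircle (2 * Real.pi)))) 0

/-- `f` is `C^∞` on the cylinder minus the singular set `{x = 0}`
(smoothness is read in the local coordinates given by the covering map). -/
def SmoothOff (f : Cyl → ℂ) : Prop :=
  ContDiffOn ℝ ∞ (fun q : ℝ × ℝ => f (cover q)) {q | q.1 ≠ 0}

/-! ### The space of test functions -/

/-- `f ∈ C_0^∞({x ≠ 0})`: a smooth function on the cylinder whose support is compact and
does not meet `{x = 0}`. -/
structure IsTest (f : Cyl → ℂ) : Prop where
  smooth : ContDiff ℝ ∞ (fun q : ℝ × ℝ => f (cover q))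
  compact : HasCompactSupport f
  off : tsupport f ⊆ {p | p.1 ≠ 0}

theorem continuous_cover : Continuous cover :=
  continuous_fst.prodMk ((AddCircle.continuous_mk' _).comp continuous_snd)

theorem isOpenQuotientMap_cover : IsOpenQuotientMap cover :=
  IsOpenQuotientMap.id.prodMap
    (QuotientAddGroup.isOpenQuotientMap_mk (N := AddSubgroup.zmultiples (2 * Real.pi)))

theorem IsTest.continuous {f : Cyl → ℂ} (hf : IsTest f) : Continuous f :=
  isOpenQuotientMap_cover.continuous_comp_iff.1 hf.smooth.continuous

theorem IsTest.of_tsupport {f g : Cyl → ℂ} (hg : IsTest g)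
    (hs : ContDiff ℝ ∞ (fun q : ℝ × ℝ => f (cover q)))
    (h : Function.support f ⊆ tsupport g) : IsTest f where
  smooth := hs
  compact := hg.compact.mono' h
  off := (closure_minimal h (isClosed_tsupport g)).trans hg.off

/-- The complex vector space `C_0^∞({x ≠ 0})`. -/
def testSpace : Submodule ℂ (Cyl → ℂ) where
  carrier := {f | IsTest f}
  zero_mem' :=
    { smooth := contDiff_const
      compact := HasCompactSupport.zero
      off := by simp [tsupport] }
  add_mem' {f g} hf hg :=
    { smooth := hf.smooth.add hg.smooth
      compact := hf.compact.add hg.compact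
      off := (tsupport_add f g).trans (Set.union_subset hf.off hg.off) }
  smul_mem' c f hf :=
    { smooth := contDiff_const.smul hf.smooth
      compact := hf.compact.smul_left (f := fun _ => c)
      off := (tsupport_smul_subset_right (fun _ => c) f).trans hf.off }

theorem eventuallyEq_zero {f : Cyl → ℂ} {p : Cyl} (hp : p ∉ tsupport f) :
    f =ᶠ[nhds p] 0 := notMem_tsupport_iff_eventuallyEq.1 hp

theorem hasDerivAt_dx {f : Cyl → ℂ} (hf : IsTest f) (q : ℝ × ℝ) :
    HasDerivAt (fun s : ℝ => f (cover (s, q.2)))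
      (fderiv ℝ (fun q : ℝ × ℝ => f (cover q)) q (1, 0)) q.1 := by
  have h := ((hf.smooth.differentiable (by simp)) q).hasFDerivAt
  have h2 : HasDerivAt (fun s : ℝ => ((s, q.2) : ℝ × ℝ)) (1, 0) q.1 :=
    (hasDerivAt_id q.1).prodMk (hasDerivAt_const q.1 q.2)
  exact HasFDerivAt.comp_hasDerivAt (x := q.1) (l := fun q : ℝ × ℝ => f (cover q)) h h2

theorem hasDerivAt_dy {f : Cyl → ℂ} (hf : IsTest f) (q : ℝ × ℝ) :
    HasDerivAt (fun t : ℝ => f ((cover q).1, (cover q).2 + (t : AddCircle (2 * Real.pi))))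
      (fderiv ℝ (fun q : ℝ × ℝ => f (cover q)) q (0, 1)) 0 := by
  have h := ((hf.smooth.differentiable (by simp)) q).hasFDerivAt
  have h2 : HasDerivAt (fun t : ℝ => ((q.1, q.2 + t) : ℝ × ℝ)) (0, 1) 0 :=
    (hasDerivAt_const 0 q.1).prodMk ((hasDerivAt_id 0).const_add q.2)
  have h0 : ((q.1, q.2 + 0) : ℝ × ℝ) = q := by simp
  have := HasFDerivAt.comp_hasDerivAt (x := (0 : ℝ)) (f := fun t : ℝ => ((q.1, q.2 + t) : ℝ × ℝ))
    (l := fun q : ℝ × ℝ => f (cover q)) (l' := fderiv ℝ (fun q : ℝ × ℝ => f (cover q)) q)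
    (by simpa using h) h2
  exact this

theorem dx_cover {f : Cyl → ℂ} (hf : IsTest f) (q : ℝ × ℝ) :
    dx f (cover q) = fderiv ℝ (fun q : ℝ × ℝ => f (cover q)) q (1, 0) :=
  (hasDerivAt_dx hf q).deriv

theorem dy_cover {f : Cyl → ℂ} (hf : IsTest f) (q : ℝ × ℝ) :
    dy f (cover q) = fderiv ℝ (fun q : ℝ × ℝ => f (cover q)) q (0, 1) :=
  (hasDerivAt_dy hf q).deriv

theorem IsTest.dx {f : Cyl → ℂ} (hf : IsTest f) : IsTest (dx f) := by
  refine hf.of_tsupport ?_ ?_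
  · simp_rw [dx_cover hf]
    exact (hf.smooth.fderiv_right (m := ∞) (by simp)).clm_apply contDiff_const
  · intro p hp
    by_contra h
    refine hp ?_
    have h1 : (fun s : ℝ => f (s, p.2)) =ᶠ[nhds p.1] fun _ => 0 := by
      have hc : ContinuousAt (fun s : ℝ => ((s, p.2) : Cyl)) p.1 := by fun_prop
      exact hc.eventually (eventuallyEq_zero h)
    simp [AlphaGrushin.dx, h1.deriv_eq]

theorem IsTest.dy {f : Cyl → ℂ} (hf : IsTest f) : IsTest (dy f) := by
  refine hf.of_tsupport ?_ ?_
  · simp_rw [dy_cover hf]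
    exact (hf.smooth.fderiv_right (m := ∞) (by simp)).clm_apply contDiff_const
  · intro p hp
    by_contra h
    refine hp ?_
    have h1 : (fun t : ℝ => f (p.1, p.2 + (t : AddCircle (2 * Real.pi)))) =ᶠ[nhds 0]
        fun _ => 0 := by
      have hc : Filter.Tendsto (fun t : ℝ => ((p.1, p.2 + (t : AddCircle (2 * Real.pi))) : Cyl))
          (nhds 0) (nhds p) := by
        have hk : Continuous
            (fun t : ℝ => ((p.1, p.2 + (t : AddCircle (2 * Real.pi))) : Cyl)) :=
          continuous_const.prodMk (continuous_const.add (AddCircle.continuous_mk' _))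
        simpa using hk.tendsto 0
      exact hc.eventually (eventuallyEq_zero h)
    simp [AlphaGrushin.dy, h1.deriv_eq]

theorem IsTest.mul {c f : Cyl → ℂ} (hc : SmoothOff c) (hf : IsTest f) :
    IsTest (fun p => c p * f p) := by
  refine hf.of_tsupport ?_ ?_
  · rw [contDiff_iff_contDiffAt]
    intro q
    by_cases hq : q.1 = 0
    · have h : cover q ∉ tsupport f := fun h => hf.off h hq
      have h1 : (fun q : ℝ × ℝ => c (cover q) * f (cover q)) =ᶠ[nhds q] fun _ => 0 := by
        filter_upwards [continuous_cover.continuousAt.eventually (eventuallyEq_zero h)] with r hr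
        simp [hr]
      exact contDiffAt_const.congr_of_eventuallyEq h1
    · have ho : IsOpen {q : ℝ × ℝ | q.1 ≠ 0} := isOpen_ne_fun continuous_fst continuous_const
      exact (hc.contDiffAt (ho.mem_nhds hq)).mul hf.smooth.contDiffAt
  · intro p hp
    exact subset_tsupport _ (right_ne_zero_of_mul hp)

/-- `∂_x` on test functions. -/
def dxLin : testSpace →ₗ[ℂ] testSpace where
  toFun f := ⟨dx f, f.2.dx⟩
  map_add' f g := by
    ext p
    obtain ⟨q, rfl⟩ := isOpenQuotientMap_cover.surjective p
    exact ((hasDerivAt_dx f.2 q).add (hasDerivAt_dx g.2 q)).deriv.trans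
      (congrArg₂ (· + ·) (dx_cover f.2 q).symm (dx_cover g.2 q).symm)
  map_smul' c f := by
    ext p
    obtain ⟨q, rfl⟩ := isOpenQuotientMap_cover.surjective p
    exact ((hasDerivAt_dx f.2 q).const_mul c).deriv.trans
      (congrArg (c * ·) (dx_cover f.2 q).symm)

/-- `∂_y` on test functions. -/
def dyLin : testSpace →ₗ[ℂ] testSpace where
  toFun f := ⟨dy f, f.2.dy⟩
  map_add' f g := by
    ext p
    obtain ⟨q, rfl⟩ := isOpenQuotientMap_cover.surjective p
    exact ((hasDerivAt_dy f.2 q).add (hasDerivAt_dy g.2 q)).deriv.trans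
      (congrArg₂ (· + ·) (dy_cover f.2 q).symm (dy_cover g.2 q).symm)
  map_smul' c f := by
    ext p
    obtain ⟨q, rfl⟩ := isOpenQuotientMap_cover.surjective p
    exact ((hasDerivAt_dy f.2 q).const_mul c).deriv.trans
      (congrArg (c * ·) (dy_cover f.2 q).symm)

/-- Multiplication by a function that is smooth off `{x = 0}`, on test functions. -/
def mulLin (c : Cyl → ℂ) (hc : SmoothOff c) : testSpace →ₗ[ℂ] testSpace where
  toFun f := ⟨fun p => c p * (f : Cyl → ℂ) p, f.2.mul hc⟩
  map_add' f g := by ext p; exact mul_add _ _ _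
  map_smul' a f := by ext p; exact mul_left_comm _ _ _

/-! ### The Laplace-Beltrami operator of an orthonormal frame -/

/-- A real vector field on the cylinder, by its components along `∂_x` and `∂_y`. -/
abbrev VField : Type := Cyl → Fin 2 → ℝ

/-- The matrix whose columns are the components of `X` and `Y`. -/
def frameMatrix (X Y : VField) (p : Cyl) : Matrix (Fin 2) (Fin 2) ℝ :=
  !![X p 0, Y p 0; X p 1, Y p 1]

/-- The matrix `g` of the Riemannian metric for which `X, Y` is an orthonormal frame (where they
are linearly independent): `Aᵀ g A = 1` for the frame matrix `A`, i.e. `g = (A Aᵀ)⁻¹`. -/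
def metric (X Y : VField) (p : Cyl) : Matrix (Fin 2) (Fin 2) ℝ :=
  (frameMatrix X Y p * (frameMatrix X Y p).transpose)⁻¹

/-- The density `ω = √(det g)` of the Riemannian area with respect to `dx dy`. -/
def areaDensity (X Y : VField) (p : Cyl) : ℝ := Real.sqrt (metric X Y p).det

/-- The Riemannian area `dω = ω dx dy`. -/
def areaMeasure (X Y : VField) : Measure Cyl :=
  volume.withDensity fun p => ENNReal.ofReal (areaDensity X Y p)

/-- The Lie derivative `X(f)`. -/
def lieDeriv (X : VField) (f : Cyl → ℂ) (p : Cyl) : ℂ :=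
  (X p 0 : ℂ) * dx f p + (X p 1 : ℂ) * dy f p

/-- The gradient `∇f = X(f) X + Y(f) Y`. -/
def gradient (X Y : VField) (f : Cyl → ℂ) (p : Cyl) (i : Fin 2) : ℂ :=
  (X p i : ℂ) * lieDeriv X f p + (Y p i : ℂ) * lieDeriv Y f p

/-- The divergence `div V = ρ⁻¹ (∂_x (ρ V₀) + ∂_y (ρ V₁))` with respect to the area `ρ dx dy`. -/
def divergence (ρ : Cyl → ℝ) (V : Cyl → Fin 2 → ℂ) (p : Cyl) : ℂ :=
  (ρ p : ℂ)⁻¹ * (dx (fun r => (ρ r : ℂ) * V r 0) p + dy (fun r => (ρ r : ℂ) * V r 1) p)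

/-- The Laplace-Beltrami operator `Δf = div ∇f`. -/
def laplaceBeltrami (X Y : VField) (f : Cyl → ℂ) : Cyl → ℂ :=
  divergence (areaDensity X Y) (gradient X Y f)

/-- The vector field `(1, 0)`. -/
def fieldX : VField := fun _ => ![1, 0]

/-- The vector field `(0, |x|^α)`. -/
def fieldY (α : ℝ) : VField := fun p => ![0, |p.1| ^ α]

/-- The differential expression `∂_x² v - (α/2)(α/2 + 1) x⁻² v + |x|^{2α} ∂_y² v`. -/
def transformedLaplacian (α : ℝ) (v : Cyl → ℂ) (p : Cyl) : ℂ :=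
  dx (dx v) p - ((α / 2 * (α / 2 + 1) / p.1 ^ 2 : ℝ) : ℂ) * v p
    + ((|p.1| ^ (2 * α) : ℝ) : ℂ) * dy (dy v) p

/-! ### Both expressions map test functions to test functions -/

theorem det_metric (α : ℝ) (p : Cyl) :
    (metric fieldX (fieldY α) p).det = ((|p.1| ^ α)⁻¹) ^ 2 := by
  rw [metric, Matrix.det_nonsing_inv, Matrix.det_mul, Matrix.det_transpose]
  simp [frameMatrix, fieldX, fieldY, Matrix.det_fin_two, sq]

theorem areaDensity_eq (α : ℝ) {p : Cyl} (hp : p.1 ≠ 0) :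
    areaDensity fieldX (fieldY α) p = |p.1| ^ (-α) := by
  have h : 0 < |p.1| := abs_pos.2 hp
  have h2 : 0 < |p.1| ^ α := Real.rpow_pos_of_pos h α
  rw [areaDensity, det_metric, Real.sqrt_sq (inv_nonneg.2 h2.le), Real.rpow_neg h.le]

theorem smoothOff_ofReal {φ : ℝ → ℝ} (h : ∀ x, x ≠ 0 → ContDiffAt ℝ ∞ φ x) {c : Cyl → ℂ}
    (hc : ∀ p : Cyl, p.1 ≠ 0 → c p = (φ p.1 : ℂ)) : SmoothOff c := by
  have h1 : ContDiffOn ℝ ∞ (fun q : ℝ × ℝ => (φ q.1 : ℂ)) {q | q.1 ≠ 0} := by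
    intro q hq
    exact (Complex.ofRealCLM.contDiff.contDiffAt.comp q
      ((h q.1 hq).comp q contDiff_fst.contDiffAt)).contDiffWithinAt
  exact h1.congr fun q hq => hc (cover q) hq

theorem contDiffAt_abs_rpow (β x : ℝ) (hx : x ≠ 0) :
    ContDiffAt ℝ ∞ (fun x : ℝ => |x| ^ β) x :=
  (contDiffAt_abs hx).rpow_const_of_ne (abs_ne_zero.2 hx)

theorem smoothOff_density (α : ℝ) :
    SmoothOff fun p => ((areaDensity fieldX (fieldY α) p : ℝ) : ℂ) :=
  smoothOff_ofReal (contDiffAt_abs_rpow (-α)) fun p hp => by rw [areaDensity_eq α hp]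

theorem smoothOff_density_inv (α : ℝ) :
    SmoothOff fun p => ((areaDensity fieldX (fieldY α) p : ℂ))⁻¹ :=
  smoothOff_ofReal (contDiffAt_abs_rpow α) fun p hp => by
    rw [areaDensity_eq α hp, Real.rpow_neg (abs_nonneg _)]; simp

theorem smoothOff_fieldX (i : Fin 2) : SmoothOff fun p => (fieldX p i : ℂ) :=
  smoothOff_ofReal (φ := fun _ => ![1, 0] i) (fun _ _ => contDiffAt_const) fun _ _ => rfl

theorem smoothOff_fieldY (α : ℝ) (i : Fin 2) : SmoothOff fun p => (fieldY α p i : ℂ) := by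
  refine smoothOff_ofReal (φ := fun x => ![0, |x| ^ α] i) (fun x hx => ?_) fun _ _ => rfl
  fin_cases i
  · exact contDiffAt_const
  · exact contDiffAt_abs_rpow α x hx

theorem exists_laplaceBeltrami_lin (α : ℝ) : ∃ T : testSpace →ₗ[ℂ] testSpace,
    ∀ f : testSpace, ((T f : testSpace) : Cyl → ℂ) = laplaceBeltrami fieldX (fieldY α) f := by
  let X := fun i => mulLin _ (smoothOff_fieldX i)
  let Y := fun i => mulLin _ (smoothOff_fieldY α i)
  let LX := X 0 ∘ₗ dxLin + X 1 ∘ₗ dyLin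
  let LY := Y 0 ∘ₗ dxLin + Y 1 ∘ₗ dyLin
  let G := fun i => X i ∘ₗ LX + Y i ∘ₗ LY
  let W := mulLin _ (smoothOff_density α)
  exact ⟨mulLin _ (smoothOff_density_inv α) ∘ₗ (dxLin ∘ₗ W ∘ₗ G 0 + dyLin ∘ₗ W ∘ₗ G 1),
    fun f => rfl⟩

theorem exists_transformed_lin (α : ℝ) : ∃ T : testSpace →ₗ[ℂ] testSpace,
    ∀ f : testSpace, ((T f : testSpace) : Cyl → ℂ) = transformedLaplacian α f := by
  have h1 : SmoothOff fun p => ((α / 2 * (α / 2 + 1) / p.1 ^ 2 : ℝ) : ℂ) :=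
    smoothOff_ofReal (φ := fun x => α / 2 * (α / 2 + 1) / x ^ 2)
      (fun x hx => by
        have h : x ^ 2 ≠ 0 := pow_ne_zero 2 hx
        fun_prop (disch := assumption)) fun _ _ => rfl
  have h2 : SmoothOff fun p => ((|p.1| ^ (2 * α) : ℝ) : ℂ) :=
    smoothOff_ofReal (contDiffAt_abs_rpow (2 * α)) fun _ _ => rfl
  exact ⟨dxLin ∘ₗ dxLin - mulLin _ h1 + mulLin _ h2 ∘ₗ dyLin ∘ₗ dyLin, fun f => rfl⟩

/-- `Δ` as a linear endomorphism of `C_0^∞({x ≠ 0})`. -/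
def laplaceBeltramiLin (α : ℝ) : testSpace →ₗ[ℂ] testSpace where
  toFun f := ⟨laplaceBeltrami fieldX (fieldY α) f, by
    obtain ⟨T, hT⟩ := exists_laplaceBeltrami_lin α
    exact hT f ▸ (T f).2⟩
  map_add' f g := by
    obtain ⟨T, hT⟩ := exists_laplaceBeltrami_lin α
    refine Subtype.ext ((hT (f + g)).symm.trans ?_)
    rw [map_add, Submodule.coe_add, Submodule.coe_add, hT, hT]
  map_smul' c f := by
    obtain ⟨T, hT⟩ := exists_laplaceBeltrami_lin α
    refine Subtype.ext ((hT (c • f)).symm.trans ?_)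
    rw [map_smul, Submodule.coe_smul, RingHom.id_apply, Submodule.coe_smul, hT]

/-- The transformed expression as a linear endomorphism of `C_0^∞({x ≠ 0})`. -/
def transformedLin (α : ℝ) : testSpace →ₗ[ℂ] testSpace where
  toFun f := ⟨transformedLaplacian α f, by
    obtain ⟨T, hT⟩ := exists_transformed_lin α
    exact hT f ▸ (T f).2⟩
  map_add' f g := by
    obtain ⟨T, hT⟩ := exists_transformed_lin α
    refine Subtype.ext ((hT (f + g)).symm.trans ?_)
    rw [map_add, Submodule.coe_add, Submodule.coe_add, hT, hT]
  map_smul' c f := by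
    obtain ⟨T, hT⟩ := exists_transformed_lin α
    refine Subtype.ext ((hT (c • f)).symm.trans ?_)
    rw [map_smul, Submodule.coe_smul, RingHom.id_apply, Submodule.coe_smul, hT]

/-! ### Unbounded operators in `L²` with domain `C_0^∞({x ≠ 0})` -/

/-- The map `C_0^∞({x ≠ 0}) → L²(μ)`. -/
def toL2 (μ : Measure Cyl) (hfin : ∀ f : testSpace, MemLp (f : Cyl → ℂ) 2 μ) :
    testSpace →ₗ[ℂ] Lp ℂ 2 μ where
  toFun f := (hfin f).toLp f
  map_add' f g := MemLp.toLp_add (hfin f) (hfin g)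
  map_smul' c f := MemLp.toLp_const_smul c (hfin f)

theorem toL2_injective (μ : Measure Cyl) (hfin : ∀ f : testSpace, MemLp (f : Cyl → ℂ) 2 μ)
    (hac : volume ≪ μ) : Function.Injective (toL2 μ hfin) := by
  intro f g h
  have h1 : (f : Cyl → ℂ) =ᵐ[μ] g := (MemLp.toLp_eq_toLp_iff (hfin f) (hfin g)).1 h
  exact Subtype.ext ((Continuous.ae_eq_iff_eq volume f.2.continuous g.2.continuous).1
    (hac.ae_le h1))

/-- The unbounded operator in `L²(μ)` with domain `C_0^∞({x ≠ 0})` (embedded in `L²(μ)`) that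
acts on test functions by `T`. -/
def testOperator (μ : Measure Cyl) (hfin : ∀ f : testSpace, MemLp (f : Cyl → ℂ) 2 μ)
    (hac : volume ≪ μ) (T : testSpace →ₗ[ℂ] testSpace) : Lp ℂ 2 μ →ₗ.[ℂ] Lp ℂ 2 μ where
  domain := LinearMap.range (toL2 μ hfin)
  toFun := toL2 μ hfin ∘ₗ T ∘ₗ
    (LinearEquiv.ofInjective (toL2 μ hfin) (toL2_injective μ hfin hac)).symm.toLinearMap

theorem memLp_volume (f : testSpace) : MemLp (f : Cyl → ℂ) 2 volume :=
  f.2.continuous.memLp_of_hasCompactSupport f.2.compact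

/-- The Riemannian area of the structure with orthonormal frame `(1, 0), (0, |x|^α)`. -/
def grushinArea (α : ℝ) : Measure Cyl := areaMeasure fieldX (fieldY α)

theorem measurable_areaDensity (α : ℝ) : Measurable (areaDensity fieldX (fieldY α)) := by
  have h : areaDensity fieldX (fieldY α) =
      fun p => Real.sqrt (((|p.1| ^ α)⁻¹) ^ 2) := by
    funext p
    rw [areaDensity, det_metric]
  rw [h]
  fun_prop

theorem volume_ac (α : ℝ) : (volume : Measure Cyl) ≪ grushinArea α := by
  refine withDensity_absolutelyContinuous'
    (measurable_areaDensity α).ennreal_ofReal.aemeasurable ?_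
  have h0 : ∀ᵐ p : Cyl, p.1 ≠ 0 :=
    (Measure.quasiMeasurePreserving_fst (μ := (volume : Measure ℝ))
      (ν := (volume : Measure (AddCircle (2 * Real.pi))))).ae
      (Measure.ae_ne volume (0 : ℝ))
  filter_upwards [h0] with p hp
  rw [areaDensity_eq α hp]
  simpa using Real.rpow_pos_of_pos (abs_pos.2 hp) _

theorem memLp_area (α : ℝ) (f : testSpace) : MemLp (f : Cyl → ℂ) 2 (grushinArea α) := by
  have hK : IsCompact (tsupport (f : Cyl → ℂ)) := f.2.compact
  have hfinK : grushinArea α (tsupport (f : Cyl → ℂ)) < ⊤ := by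
    rw [grushinArea, areaMeasure, withDensity_apply _ hK.measurableSet]
    have hc : ContinuousOn (areaDensity fieldX (fieldY α)) (tsupport (f : Cyl → ℂ)) := by
      have h1 : ContinuousOn (fun p : Cyl => |p.1| ^ (-α)) (tsupport (f : Cyl → ℂ)) :=
        ContinuousOn.rpow_const (by fun_prop) fun p hp => Or.inl (abs_ne_zero.2 (f.2.off hp))
      exact h1.congr fun p hp => areaDensity_eq α (f.2.off hp)
    exact (hc.integrableOn_compact hK).lintegral_lt_top
  obtain ⟨C, hC⟩ := f.2.compact.exists_bound_of_continuous f.2.continuous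
  have : IsFiniteMeasure ((grushinArea α).restrict (tsupport (f : Cyl → ℂ))) :=
    ⟨by simpa using hfinK⟩
  have h1 : MemLp (f : Cyl → ℂ) 2 ((grushinArea α).restrict (tsupport (f : Cyl → ℂ))) :=
    MemLp.of_bound f.2.continuous.aestronglyMeasurable C (Filter.Eventually.of_forall hC)
  rw [← memLp_indicator_iff_restrict hK.measurableSet] at h1
  rwa [Set.indicator_eq_self.2 (subset_tsupport _)] at h1

/-- The Laplace-Beltrami operator `Δ` of the frame `(1, 0), (0, |x|^α)`, as an unbounded operator
in `L²(ℝ × 𝕋, dω)` with domain `C_0^∞({x ≠ 0})`. -/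
def laplaceBeltramiOp (α : ℝ) : Lp ℂ 2 (grushinArea α) →ₗ.[ℂ] Lp ℂ 2 (grushinArea α) :=
  testOperator (grushinArea α) (memLp_area α) (volume_ac α) (laplaceBeltramiLin α)

/-- The operator `∂_x² - (α/2)(α/2 + 1) x⁻² + |x|^{2α} ∂_y²`, as an unbounded operator in
`L²(ℝ × 𝕋, dx dy)` with domain `C_0^∞({x ≠ 0})`. -/
def transformedOp (α : ℝ) : Lp ℂ 2 (volume : Measure Cyl) →ₗ.[ℂ] Lp ℂ 2 (volume : Measure Cyl) :=
  testOperator volume memLp_volume Measure.AbsolutelyContinuous.rfl (transformedLin α)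

/-- An unbounded operator is essentially self-adjoint if it is closable and its closure is
self-adjoint (in particular densely defined). -/
def IsEssentiallySelfAdjoint {H : Type*} [NormedAddCommGroup H] [InnerProductSpace ℂ H]
    [CompleteSpace H] (A : H →ₗ.[ℂ] H) : Prop :=
  A.IsClosable ∧ IsSelfAdjoint A.closure

end AlphaGrushin

end

open MeasureTheory
open scoped ContDiff

noncomputable section

namespace AlphaGrushin

/-! ### Criteria for essential self-adjointness in terms of the graph -/

section Criteria

variable {H : Type*} [NormedAddCommGroup H] [InnerProductSpace ℂ H]

/-! The coordinate formula for `Δ` is a direct computation: the area density is $|x|^{-\alpha}$, and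
its logarithmic derivative produces the drift $-\alpha/x$. Multiplication by $|x|^{\alpha/2}$
removes this drift and leaves an inverse square potential (`laplaceBeltrami_absPow_mul`). It is
unitary because $|x|^{\alpha}$ cancels the density, and it preserves test functions because their
supports avoid $x=0$. Essential self-adjointness can therefore be decided for the transformed
operator $A$ and transported, in a form that only mentions graphs and inner products.

For $\alpha\ge 1$, integration by parts shows that $A$ is symmetric and nonpositive, so it is enough
that $A-1$ has dense range (`IsEssentiallySelfAdjoint.of_graph`). If $u$ is orthogonal to that
range, testing against $\varphi(x)e^{iky}$ shows that each Fourier coefficient of $u$ in $y$ is, on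
each half-line, a square integrable weak solution of $w''=qw$ with $q\ge s(s+1)/x^2$ and
$s=\alpha/2\ge 1/2$. Weak solutions are classical (`exists_classical_of_weak`). Square integrability
at infinity forces $ww'\le 0$, so a nonzero solution keeps its sign and does not decay towards $0$;
comparison with the regular solution $x^{1+s}$ then gives $|w|\ge c\,x^{-s}$ near $0$, which is not
square integrable when $2s\ge 1$ (`eq_zero_of_ode`). Hence $u=0$.

For $0<\alpha<1$, both homogeneous solutions $x^{-\alpha/2}$ and $x^{1+\alpha/2}$ of the mode $k=0$
are square integrable near $0$. Cut off away from $0$ and extended by zero to $x<0$, they lie in the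
domain of the adjoint, and their Wronskian at $0$ makes the adjoint form asymmetric
(`exists_adjoint_not_symmetric`). An essentially self-adjoint operator has a symmetric adjoint. -/

/-- The relation `⟪u, A x⟫ = ⟪w, x⟫` passes to the closure of a graph. -/
theorem inner_snd_eq_of_mem_closure {G : Submodule ℂ (H × H)} {u w : H}
    (h : ∀ p ∈ G, inner ℂ u p.2 = inner ℂ w p.1) {p : H × H} (hp : p ∈ G.topologicalClosure) :
    inner ℂ u p.2 = inner ℂ w p.1 := by
  have hc : IsClosed {p : H × H | inner ℂ u p.2 = inner ℂ w p.1} :=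
    isClosed_eq (by fun_prop) (by fun_prop)
  exact closure_minimal (s := (G : Set (H × H))) h hc hp

theorem re_inner_nonpos_of_mem_closure {G : Submodule ℂ (H × H)}
    (h : ∀ p ∈ G, (inner ℂ p.1 p.2).re ≤ 0) {p : H × H} (hp : p ∈ G.topologicalClosure) :
    (inner ℂ p.1 p.2).re ≤ 0 := by
  have hc : IsClosed {p : H × H | (inner ℂ p.1 p.2).re ≤ 0} :=
    isClosed_le (Complex.continuous_re.comp (by fun_prop)) continuous_const
  exact closure_minimal (s := (G : Set (H × H))) h hc hp

/-- For a nonpositive graph, `(x, y) ↦ y - x` is bounded below. -/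
theorem norm_le_norm_sub_of_re_inner_nonpos {x y : H} (h : (inner ℂ x y).re ≤ 0) :
    ‖x‖ ≤ ‖y - x‖ := by
  have h1 : ‖x‖ * ‖x‖ ≤ ‖x‖ * ‖y - x‖ := by
    have h2 : ‖inner ℂ x (y - x)‖ ≤ ‖x‖ * ‖y - x‖ := norm_inner_le_norm _ _
    have h3 := Complex.abs_re_le_norm (inner ℂ x (y - x))
    have h4 : (inner ℂ x x).re = ‖x‖ ^ 2 := by
      simpa using inner_self_eq_norm_sq (𝕜 := ℂ) x
    rw [inner_sub_right, Complex.sub_re, h4] at h3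
    have h5 := neg_abs_le ((inner ℂ x y).re - ‖x‖ ^ 2)
    rw [inner_sub_right] at h2
    nlinarith
  rcases (norm_nonneg x).eq_or_lt with h0 | h0
  · rw [← h0]; exact norm_nonneg _
  · exact le_of_mul_le_mul_left h1 h0

/-- On a closed nonpositive graph, $(x,y)\mapsto y-x$ is bounded below and so has closed range; `hr`
says that the orthogonal complement of the range is zero. -/
theorem exists_sub_eq_of_nonpos [CompleteSpace H] {G : Submodule ℂ (H × H)}
    (hcl : IsClosed (G : Set (H × H)))
    (hn : ∀ p ∈ G, (inner ℂ p.1 p.2).re ≤ 0)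
    (hr : ∀ u, (∀ p ∈ G, inner ℂ u (p.2 - p.1) = 0) → u = 0) (w : H) :
    ∃ p ∈ G, p.2 - p.1 = w := by
  let D : G →L[ℂ] H := (ContinuousLinearMap.snd ℂ H H - ContinuousLinearMap.fst ℂ H H).comp
    G.subtypeL
  have hD : ∀ p : G, D p = p.1.2 - p.1.1 := fun p => rfl
  -- The constant 2 comes from the graph norm: $\|x\|\le\|y-x\|$ gives $\|y\|\le 2\|y-x\|$.
  have hanti : AntilipschitzWith 2 D := by
    refine AddMonoidHomClass.antilipschitz_of_bound D fun p => ?_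
    have h1 := norm_le_norm_sub_of_re_inner_nonpos (hn p.1 p.2)
    have h2 : ‖p.1.2‖ ≤ ‖p.1.2 - p.1.1‖ + ‖p.1.1‖ := by
      simpa using norm_add_le (p.1.2 - p.1.1) p.1.1
    have h3 : ‖p‖ = max ‖p.1.1‖ ‖p.1.2‖ := rfl
    rw [h3, hD]
    have h0 := norm_nonneg (p.1.2 - p.1.1)
    push_cast
    refine max_le ?_ ?_ <;> linarith
  have : CompleteSpace G := hcl.completeSpace_coe
  have hrc : IsClosed (D.range : Set H) := by
    have h : (D.range : Set H) = Set.range D := LinearMap.coe_range _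
    exact h ▸ hanti.isClosed_range D.uniformContinuous
  have htop : D.range = ⊤ := by
    have : CompleteSpace D.range := hrc.completeSpace_coe
    rw [← Submodule.orthogonal_eq_bot_iff, Submodule.eq_bot_iff]
    intro u hu
    refine hr u fun p hp => ?_
    exact (Submodule.mem_orthogonal' _ _).1 hu _ ⟨⟨p, hp⟩, rfl⟩
  obtain ⟨p, hp⟩ : w ∈ D.range := htop ▸ Submodule.mem_top
  exact ⟨p.1, p.2, hp⟩

theorem dense_domain_of_graph [CompleteSpace H] {A : H →ₗ.[ℂ] H}
    (hd : ∀ u, (∀ p ∈ A.graph, inner ℂ u p.1 = 0) → u = 0) : Dense (A.domain : Set H) := by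
  rw [Submodule.dense_iff_topologicalClosure_eq_top, Submodule.topologicalClosure_eq_top_iff,
    Submodule.eq_bot_iff]
  intro u hu
  refine hd u fun p hp => ?_
  refine (Submodule.mem_orthogonal' _ _).1 hu _ ?_
  obtain ⟨x, hx, -⟩ := (LinearPMap.mem_graph_iff A).1 hp
  exact hx ▸ x.2

/-- A densely defined, symmetric, nonpositive operator `A` such that `A - 1` has dense range is
essentially self-adjoint. -/
theorem IsEssentiallySelfAdjoint.of_graph [CompleteSpace H] {A : H →ₗ.[ℂ] H}
    (hd : ∀ u, (∀ p ∈ A.graph, inner ℂ u p.1 = 0) → u = 0)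
    (hs : ∀ p ∈ A.graph, ∀ q ∈ A.graph, inner ℂ p.1 q.2 = inner ℂ p.2 q.1)
    (hn : ∀ p ∈ A.graph, (inner ℂ p.1 p.2).re ≤ 0)
    (hr : ∀ u, (∀ p ∈ A.graph, inner ℂ u (p.2 - p.1) = 0) → u = 0) :
    IsEssentiallySelfAdjoint A := by
  have hdense := dense_domain_of_graph hd
  have hfa : A.IsFormalAdjoint A := fun x y =>
    (hs (x, A x) (A.mem_graph x) (y, A y) (A.mem_graph y)).symm
  -- Symmetry places `A` below its adjoint, which is closed.
  have hclos : A.IsClosable :=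
    (LinearPMap.adjoint_isClosed hdense).isClosable.leIsClosable
      (LinearPMap.IsFormalAdjoint.le_adjoint hdense hfa)
  refine ⟨hclos, ?_⟩
  have hg : A.closure.graph = A.graph.topologicalClosure :=
    hclos.graph_closure_eq_closure_graph.symm
  have hle : A.graph ≤ A.closure.graph := hg ▸ A.graph.le_topologicalClosure
  have hBd : Dense (A.closure.domain : Set H) :=
    hdense.mono A.le_closure.1
  have hs' : ∀ p ∈ A.closure.graph, ∀ q ∈ A.closure.graph, inner ℂ p.1 q.2 = inner ℂ p.2 q.1 := by
    intro p hp q hq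
    rw [hg] at hp hq
    refine inner_snd_eq_of_mem_closure (fun q hq => ?_) hq
    have h1 := inner_snd_eq_of_mem_closure (u := q.1) (w := q.2) (fun p hp => hs q hq p hp) hp
    rw [← inner_conj_symm, ← h1, inner_conj_symm]
  have hn' : ∀ p ∈ A.closure.graph, (inner ℂ p.1 p.2).re ≤ 0 := fun p hp =>
    re_inner_nonpos_of_mem_closure hn (hg ▸ hp)
  rw [LinearPMap.isSelfAdjoint_def]
  refine LinearPMap.eq_of_eq_graph ?_
  rw [LinearPMap.adjoint_graph_eq_graph_adjoint hBd]
  ext ⟨u, w⟩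
  rw [Submodule.mem_adjoint_iff]
  constructor
  · intro h
    -- Given $(u,w)$ in the graph of the adjoint, solve $p_2-p_1=w-u$ inside the closure. The
    -- difference $u-p_1$ is then orthogonal to the range of $A-1$, so $(u,w)=p$.
    obtain ⟨p, hp, hpw⟩ := exists_sub_eq_of_nonpos (hclos.closure_isClosed)
      hn' (fun u hu => hr u fun p hp => hu p (hle hp)) (w - u)
    have hu : u - p.1 = 0 := by
      refine hr _ fun q hq => ?_
      have h1 := sub_eq_zero.1 (h q.1 q.2 (hle hq))
      have h1' : inner ℂ u q.2 = inner ℂ w q.1 := by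
        rw [← inner_conj_symm, h1, inner_conj_symm]
      have h2 := hs' p hp q (hle hq)
      have h3 : inner ℂ (p.2 - p.1) q.1 = inner ℂ (w - u) q.1 := by rw [hpw]
      simp only [inner_sub_left, inner_sub_right] at h3 ⊢
      rw [h1', h2]
      linear_combination -h3
    have hu' : u = p.1 := sub_eq_zero.1 hu
    have hw : w = p.2 := by
      have := hpw
      rw [hu'] at this
      exact (sub_left_inj.1 this).symm
    rw [hu', hw]
    exact hp
  · intro h a b hab
    exact sub_eq_zero.2 (hs' (a, b) hab (u, w) h).symm

/-- An essentially self-adjoint operator has a symmetric adjoint. -/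
theorem IsEssentiallySelfAdjoint.inner_eq_of_adjoint [CompleteSpace H] {A : H →ₗ.[ℂ] H}
    (hA : IsEssentiallySelfAdjoint A) {u u' v v' : H}
    (hu : ∀ p ∈ A.graph, inner ℂ u p.2 = inner ℂ u' p.1)
    (hv : ∀ p ∈ A.graph, inner ℂ v p.2 = inner ℂ v' p.1) :
    inner ℂ v u' = inner ℂ v' u := by
  obtain ⟨hclos, hsa⟩ := hA
  have hg : A.closure.graph = A.graph.topologicalClosure :=
    hclos.graph_closure_eq_closure_graph.symm
  -- Self-adjointness of the closure puts the adjoint pair $(u,u')$ in the closed graph, where the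
  -- relation defining $(v,v')$ persists by continuity.
  have hmem : (u, u') ∈ A.closure.graph := by
    have h : (u, u') ∈ A.closure.adjoint.graph := by
      rw [LinearPMap.adjoint_graph_eq_graph_adjoint hsa.dense_domain, Submodule.mem_adjoint_iff]
      intro a b hab
      have := inner_snd_eq_of_mem_closure hu (hg ▸ hab)
      rw [sub_eq_zero, ← inner_conj_symm, this, inner_conj_symm]
    rwa [LinearPMap.isSelfAdjoint_def.1 hsa] at h
  exact inner_snd_eq_of_mem_closure (p := (u, u')) hv (hg ▸ hmem)

end Criteria

/-! ### Square integrable solutions of `v'' = q v` on the half-line -/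

/-- A positive lower bound on a half-line prevents integrability. -/
theorem not_integrableOn_Ioi_of_le {f : ℝ → ℝ} {a c : ℝ} (hc : 0 < c)
    (hf : ∀ x ∈ Set.Ioi a, c ≤ f x) : ¬ IntegrableOn f (Set.Ioi a) := by
  intro h
  have h1 : IntegrableOn (fun _ : ℝ => c) (Set.Ioi a) := by
    refine Integrable.mono' h aestronglyMeasurable_const ?_
    refine (ae_restrict_iff' measurableSet_Ioi).2 (Filter.Eventually.of_forall fun x hx => ?_)
    rw [Real.norm_of_nonneg hc.le]
    exact hf x hx
  rw [integrableOn_const_iff] at h1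
  simp [hc.ne'] at h1

/-- A lower bound by `c / x` near `0` prevents integrability. -/
theorem not_integrableOn_Ioo_of_le {f : ℝ → ℝ} {a c : ℝ} (ha : 0 < a) (hc : 0 < c)
    (hf : ∀ x ∈ Set.Ioo 0 a, c * x⁻¹ ≤ f x) : ¬ IntegrableOn f (Set.Ioo 0 a) := by
  intro h
  have h1 : IntegrableOn (fun x : ℝ => c * x⁻¹) (Set.Ioo 0 a) := by
    refine Integrable.mono' h (by fun_prop) ?_
    refine (ae_restrict_iff' measurableSet_Ioo).2 (Filter.Eventually.of_forall fun x hx => ?_)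
    rw [Real.norm_of_nonneg (mul_nonneg hc.le (inv_nonneg.2 hx.1.le))]
    exact hf x hx
  have h2 : IntegrableOn (fun x : ℝ => x⁻¹) (Set.Ioo 0 a) := by
    have := h1.const_mul c⁻¹
    simpa [IntegrableOn, hc.ne'] using this
  have h3 : IntervalIntegrable (fun x : ℝ => x⁻¹) volume 0 a := by
    rw [intervalIntegrable_iff, Set.uIoc_of_le ha.le]
    exact (integrableOn_Ioc_iff_integrableOn_Ioo (by simp)).2 h2
  rw [intervalIntegrable_inv_iff] at h3
  rcases h3 with h3 | h3
  · exact ha.ne h3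
  · exact h3 Set.left_mem_uIcc

theorem monotoneOn_of_hasDerivAt_nonneg {D : Set ℝ} (hD : Convex ℝ D) {f f' : ℝ → ℝ}
    (hf : ∀ x ∈ D, HasDerivAt f (f' x) x) (h0 : ∀ x ∈ D, 0 ≤ f' x) : MonotoneOn f D := by
  refine monotoneOn_of_deriv_nonneg hD (fun x hx => (hf x hx).continuousAt.continuousWithinAt)
    (fun x hx => (hf x (interior_subset hx)).differentiableAt.differentiableWithinAt)
    fun x hx => ?_
  rw [(hf x (interior_subset hx)).deriv]
  exact h0 x (interior_subset hx)

section ODE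

variable {s : ℝ} {q v v' : ℝ → ℝ}

/-- A square integrable solution of `v'' = q v` with `q ≥ 0` on `(0, ∞)` satisfies `v v' ≤ 0`. -/
theorem mul_deriv_nonpos_of_ode (hq : ∀ x, 0 < x → 0 ≤ q x)
    (hv : ∀ x, 0 < x → HasDerivAt v (v' x) x)
    (hv' : ∀ x, 0 < x → HasDerivAt v' (q x * v x) x)
    (hL : IntegrableOn (fun x => v x ^ 2) (Set.Ioi 0)) {x : ℝ} (hx : 0 < x) :
    v x * v' x ≤ 0 := by
  by_contra! hpos
  -- Since $(vv')'=v'^2+qv^2\ge 0$, a positive value of $vv'$ persists to the right. Then $v^2$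
  -- increases from a positive value and cannot be integrable.
  have hmono : MonotoneOn (fun x => v x * v' x) (Set.Ioi 0) := by
    refine monotoneOn_of_hasDerivAt_nonneg (convex_Ioi 0)
      (fun y hy => (hv y hy).mul (hv' y hy)) fun y hy => ?_
    have := hq y hy
    have h1 : v' y * v' y + v y * (q y * v y) = v' y ^ 2 + q y * v y ^ 2 := by ring
    rw [h1]; positivity
  have hmono2 : MonotoneOn (fun x => v x ^ 2) (Set.Ici x) := by
    refine monotoneOn_of_hasDerivAt_nonneg (convex_Ici x)
      (fun y hy => (hv y (hx.trans_le hy)).pow 2) fun y hy => ?_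
    have := hmono hx (hx.trans_le hy) hy
    simp only at this
    simp
    nlinarith
  have hvx : 0 < v x ^ 2 := by
    have : v x ≠ 0 := by rintro h; simp [h] at hpos
    positivity
  exact not_integrableOn_Ioi_of_le hvx (fun y hy =>
    hmono2 Set.self_mem_Ici (Set.mem_Ici.2 (le_of_lt hy)) (le_of_lt hy))
    (hL.mono_set (Set.Ioi_subset_Ioi hx.le))

/-- Near `0`, a positive decreasing solution is bounded below by a multiple of `x ^ (-s)`. -/
theorem exists_lower_bound_of_ode {b : ℝ} (hb : 0 < b) (hs : 0 < s)
    (hq : ∀ x, 0 < x → s * (s + 1) / x ^ 2 ≤ q x)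
    (hv : ∀ x, 0 < x → HasDerivAt v (v' x) x)
    (hv' : ∀ x, 0 < x → HasDerivAt v' (q x * v x) x)
    (hpos : ∀ x ∈ Set.Ioc 0 b, 0 < v x) (hneg : ∀ x ∈ Set.Ioc 0 b, v' x ≤ 0) :
    ∃ κ > 0, ∃ C, ∀ x ∈ Set.Ioc 0 b, κ * x ^ (-s) - C * x ^ (1 + s) ≤ v x := by
  -- The regular solution of the comparison equation $g''=s(s+1)x^{-2}g$.
  set g : ℝ → ℝ := fun x => x ^ (1 + s) with hg
  set g' : ℝ → ℝ := fun x => (1 + s) * x ^ s with hg'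
  have hgd : ∀ x, 0 < x → HasDerivAt g (g' x) x := fun x hx => by
    have := Real.hasDerivAt_rpow_const (x := x) (p := 1 + s) (Or.inl hx.ne')
    simpa [hg, hg'] using this
  have hgd' : ∀ x, 0 < x → HasDerivAt g' (s * (s + 1) / x ^ 2 * g x) x := fun x hx => by
    have := (Real.hasDerivAt_rpow_const (x := x) (p := s) (Or.inl hx.ne')).const_mul (1 + s)
    refine this.congr_deriv ?_
    have h1 : x ^ (1 + s) = x ^ 2 * x ^ (s - 1) := by
      rw [← Real.rpow_natCast, ← Real.rpow_add hx]; congr 1; push_cast; ring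
    rw [hg]; simp only; rw [h1]; field_simp; ring
  have hgp : ∀ x, 0 < x → 0 < g x := fun x hx => Real.rpow_pos_of_pos hx _
  -- The Wronskian is nondecreasing because $q$ dominates the comparison potential, so $W\le
  -- W(b)=-\kappa<0$ on $(0,b]$. As $(v/g)'=W/g^2\le-\kappa x^{-2-2s}$, integrating from $x$ to $b$
  -- yields the bound.
  set W : ℝ → ℝ := fun x => v' x * g x - v x * g' x with hW
  have hWd : ∀ x, 0 < x → HasDerivAt W ((q x - s * (s + 1) / x ^ 2) * (v x * g x)) x :=
    fun x hx => (((hv' x hx).mul (hgd x hx)).sub ((hv x hx).mul (hgd' x hx))).congr_deriv (by ring)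
  have hWm : MonotoneOn W (Set.Ioc 0 b) := by
    refine monotoneOn_of_hasDerivAt_nonneg (convex_Ioc 0 b) (fun x hx => hWd x hx.1) fun x hx => ?_
    exact mul_nonneg (sub_nonneg.2 (hq x hx.1)) (mul_nonneg (hpos x hx).le (hgp x hx.1).le)
  set κ := -W b with hκ
  have hbm : b ∈ Set.Ioc 0 b := ⟨hb, le_rfl⟩
  have hκp : 0 < κ := by
    have h1 : v' b * g b ≤ 0 := mul_nonpos_of_nonpos_of_nonneg (hneg b hbm) (hgp b hb).le
    have h2 : 0 < v b * g' b := mul_pos (hpos b hbm)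
      (mul_pos (by linarith) (Real.rpow_pos_of_pos hb _))
    simp only [hκ, hW]; linarith
  -- the quotient by the regular solution, corrected
  set F : ℝ → ℝ := fun x => -(v x / g x - κ / (1 + 2 * s) * x ^ (-(1 + 2 * s))) with hF
  have hs2 : 1 + 2 * s ≠ 0 := by linarith
  have hFd : ∀ x, 0 < x → HasDerivAt F (-(W x / g x ^ 2 + κ / g x ^ 2)) x := fun x hx => by
    have h1 := (hv x hx).div (hgd x hx) (hgp x hx).ne'
    have h2 := (Real.hasDerivAt_rpow_const (x := x) (p := -(1 + 2 * s)) (Or.inl hx.ne')).const_mul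
      (κ / (1 + 2 * s))
    refine ((h1.sub h2).neg).congr_deriv ?_
    have h3 : x ^ (-(1 + 2 * s) - 1) = (g x ^ 2)⁻¹ := by
      rw [hg]; simp only
      rw [← Real.rpow_natCast, ← Real.rpow_mul hx.le, ← Real.rpow_neg hx.le]
      congr 1; push_cast; ring
    rw [h3, hW]
    have := (hgp x hx).ne'
    field_simp
    ring
  have hFm : MonotoneOn F (Set.Ioc 0 b) := by
    refine monotoneOn_of_hasDerivAt_nonneg (convex_Ioc 0 b) (fun x hx => hFd x hx.1) fun x hx => ?_
    have h1 : W x ≤ -κ := by rw [hκ, neg_neg]; exact hWm hx hbm hx.2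
    rw [← add_div, ← neg_div]
    exact div_nonneg (by linarith) (sq_nonneg _)
  refine ⟨κ / (1 + 2 * s), by positivity, F b, fun x hx => ?_⟩
  have h1 := hFm hx hbm hx.2
  have h2 : -F x * g x = v x - κ / (1 + 2 * s) * x ^ (-s) := by
    have h3 : x ^ (-(1 + 2 * s)) * g x = x ^ (-s) := by
      rw [hg]; simp only
      rw [← Real.rpow_add hx.1]; congr 1; ring
    have := (hgp x hx.1).ne'
    calc -F x * g x = v x / g x * g x - κ / (1 + 2 * s) * (x ^ (-(1 + 2 * s)) * g x) := by
          simp only [hF]; ring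
      _ = _ := by rw [h3, div_mul_cancel₀ _ this]
  have h4 : F x * g x ≤ F b * g x := mul_le_mul_of_nonneg_right h1 (hgp x hx.1).le
  change _ - F b * g x ≤ _
  linarith

/-- In the limit point case at both ends, `v'' = q v` has no nonzero square integrable solution. -/
theorem eq_zero_of_ode (hs : 1 / 2 ≤ s) (hq : ∀ x, 0 < x → s * (s + 1) / x ^ 2 ≤ q x)
    (hv : ∀ x, 0 < x → HasDerivAt v (v' x) x)
    (hv' : ∀ x, 0 < x → HasDerivAt v' (q x * v x) x)
    (hL : IntegrableOn (fun x => v x ^ 2) (Set.Ioi 0)) {b : ℝ} (hb : 0 < b) : v b = 0 := by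
  wlog hvb : 0 ≤ v b generalizing v v'
  · have := this (v := fun x => -v x) (v' := fun x => -v' x) (fun x hx => (hv x hx).neg)
      (fun x hx => ((hv' x hx).neg).congr_deriv (by ring)) (by simpa using hL) (by linarith)
    linarith
  by_contra hne
  have hvb : 0 < v b := lt_of_le_of_ne hvb (Ne.symm hne)
  have hs0 : 0 < s := by linarith
  have hq0 : ∀ x, 0 < x → 0 ≤ q x := fun x hx => le_trans (by positivity) (hq x hx)
  have hvv : ∀ x, 0 < x → v x * v' x ≤ 0 := fun x hx => mul_deriv_nonpos_of_ode hq0 hv hv' hL hx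
  have hanti : MonotoneOn (fun x => -v x ^ 2) (Set.Ioi 0) := by
    refine monotoneOn_of_hasDerivAt_nonneg (convex_Ioi 0)
      (fun y hy => ((hv y hy).pow 2).neg) fun y hy => ?_
    have := hvv y hy
    simp
    nlinarith
  -- The square $v^2$ is nonincreasing, so a zero to the left of $b$ would force $v(b)=0$.
  have hne0 : ∀ x ∈ Set.Ioc 0 b, v x ≠ 0 := fun x hx h0 => by
    have := hanti hx.1 hb hx.2
    simp [h0] at this
    nlinarith
  have hpos : ∀ x ∈ Set.Ioc 0 b, 0 < v x := by
    intro x hx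
    by_contra! hle
    have hc : ContinuousOn v (Set.Icc x b) := fun y hy =>
      (hv y (hx.1.trans_le hy.1)).continuousAt.continuousWithinAt
    obtain ⟨y, hy, hy0⟩ := intermediate_value_Icc hx.2 hc ⟨hle, hvb.le⟩
    exact hne0 y ⟨hx.1.trans_le hy.1, hy.2⟩ hy0
  have hneg : ∀ x ∈ Set.Ioc 0 b, v' x ≤ 0 := fun x hx => by
    have := hvv x hx.1
    have := hpos x hx
    nlinarith
  obtain ⟨κ, hκ, C, hlow⟩ := exists_lower_bound_of_ode hb hs0 hq hv hv' hpos hneg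
  have hlim : Filter.Tendsto (fun x : ℝ => C * x ^ (1 + 2 * s)) (nhdsWithin 0 (Set.Ioi 0))
      (nhds 0) := by
    have : Filter.Tendsto (fun x : ℝ => C * x ^ (1 + 2 * s)) (nhds 0) (nhds (C * 0 ^ (1 + 2 * s))) :=
      ((Real.continuousAt_rpow_const 0 (1 + 2 * s) (Or.inr (by linarith))).tendsto).const_mul C
    rw [Real.zero_rpow (by linarith), mul_zero] at this
    exact this.mono_left nhdsWithin_le_nhds
  have hev : ∀ᶠ x : ℝ in nhdsWithin 0 (Set.Ioi 0), C * x ^ (1 + 2 * s) < κ / 2 :=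
    hlim.eventually (gt_mem_nhds (by positivity))
  obtain ⟨δ, hδ, hδ'⟩ := mem_nhdsGT_iff_exists_Ioo_subset.1 hev
  have hδ0 : (0 : ℝ) < δ := hδ
  -- Below $\delta$ the correction takes at most half of $\kappa x^{-s}$; below $b$ the lower bound
  -- applies; below $1$ the inequality $2s\ge1$ gives $x^{-2s}\ge x^{-1}$.
  refine not_integrableOn_Ioo_of_le (f := fun x => v x ^ 2) (a := min δ (min b 1)) (c := (κ / 2) ^ 2)
    (by positivity) (by positivity) (fun x hx => ?_)
    (hL.mono_set fun x hx => hx.1)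
  have hx0 : 0 < x := hx.1
  have hxδ : x < δ := hx.2.trans_le (min_le_left _ _)
  have hxb : x < b := hx.2.trans_le ((min_le_right _ _).trans (min_le_left _ _))
  have hx1 : x < 1 := hx.2.trans_le ((min_le_right _ _).trans (min_le_right _ _))
  have h1 : C * x ^ (1 + 2 * s) < κ / 2 := hδ' ⟨hx0, hxδ⟩
  have h2 := hlow x ⟨hx0, hxb.le⟩
  have h3 : x ^ (1 + s) = x ^ (1 + 2 * s) * x ^ (-s) := by
    rw [← Real.rpow_add hx0]; congr 1; ring
  have h4 : 0 < x ^ (-s) := Real.rpow_pos_of_pos hx0 _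
  have h5 : κ / 2 * x ^ (-s) ≤ v x := by
    rw [h3] at h2
    nlinarith
  have h6 : x⁻¹ ≤ (x ^ (-s)) ^ 2 := by
    rw [← Real.rpow_natCast, ← Real.rpow_mul hx0.le, ← Real.rpow_neg_one]
    exact Real.rpow_le_rpow_of_exponent_ge hx0 hx1.le (by push_cast; linarith)
  calc (κ / 2) ^ 2 * x⁻¹ ≤ (κ / 2) ^ 2 * (x ^ (-s)) ^ 2 := by gcongr
    _ = (κ / 2 * x ^ (-s)) ^ 2 := by ring
    _ ≤ v x ^ 2 := by gcongr

end ODE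

/-! ### Weak solutions on the half-line -/

/-- Real test functions on `(0, ∞)`. -/
structure HalfTest (φ : ℝ → ℝ) : Prop where
  smooth : ContDiff ℝ ∞ φ
  compact : HasCompactSupport φ
  pos : tsupport φ ⊆ Set.Ioi 0

namespace HalfTest

variable {φ ψ : ℝ → ℝ}

theorem deriv (hφ : HalfTest φ) : HalfTest (deriv φ) where
  smooth := (contDiff_infty_iff_deriv.1 hφ.smooth).2
  compact := hφ.compact.deriv
  pos := tsupport_deriv_subset.trans hφ.pos

theorem hasDerivAt (hφ : HalfTest φ) (x : ℝ) : HasDerivAt φ (_root_.deriv φ x) x :=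
  (hφ.smooth.differentiable (by simp) x).hasDerivAt

theorem sub (hφ : HalfTest φ) (hψ : HalfTest ψ) : HalfTest (fun x => φ x - ψ x) where
  smooth := hφ.smooth.sub hψ.smooth
  compact := hφ.compact.sub hψ.compact
  pos := (tsupport_sub φ ψ).trans (Set.union_subset hφ.pos hψ.pos)

theorem const_mul (c : ℝ) (hφ : HalfTest φ) : HalfTest (fun x => c * φ x) where
  smooth := contDiff_const.mul hφ.smooth
  compact := hφ.compact.mul_left (f := fun _ => c)
  pos := (tsupport_mul_subset_right (f := fun _ => c)).trans hφ.pos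

/-- The support of a test function lies in some `(a, b)` with `0 < a < 1 < b`. -/
theorem exists_bounds (hφ : HalfTest φ) :
    ∃ a b, 0 < a ∧ a < 1 ∧ 1 < b ∧ tsupport φ ⊆ Set.Ioo a b := by
  have hK : IsCompact (tsupport φ) := hφ.compact
  obtain ⟨b, hb⟩ := hK.bddAbove
  have h1 : ∃ a, 0 < a ∧ ∀ x ∈ tsupport φ, a < x := by
    rcases (tsupport φ).eq_empty_or_nonempty with h | h
    · exact ⟨1, one_pos, by simp [h]⟩
    · obtain ⟨m, hm, hmin⟩ := hK.exists_isMinOn h continuousOn_id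
      have hm0 : 0 < m := hφ.pos hm
      exact ⟨m / 2, by linarith, fun x hx => by have : m ≤ x := hmin hx; linarith⟩
  obtain ⟨a, ha, ha'⟩ := h1
  -- The interval is enlarged to contain $1$, the base point of the primitives used for weak
  -- solutions.
  refine ⟨min a (1 / 2), max b 1 + 1, by positivity, ?_, ?_, fun x hx => ⟨?_, ?_⟩⟩
  · exact (min_le_right _ _).trans_lt (by norm_num)
  · linarith [le_max_right b 1]
  · exact (min_le_left _ _).trans_lt (ha' x hx)
  · linarith [le_max_left b 1, hb hx]

theorem integrable_mul (hφ : HalfTest φ) {w : ℝ → ℝ} (hw : LocallyIntegrableOn w (Set.Ioi 0)) :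
    Integrable (fun x => w x * φ x) := by
  have h1 : IntegrableOn w (tsupport φ) := hw.integrableOn_compact_subset hφ.pos hφ.compact
  have h2 : IntegrableOn (fun x => w x * φ x) (tsupport φ) :=
    h1.mul_continuousOn hφ.smooth.continuous.continuousOn hφ.compact
  rw [← integrableOn_iff_integrable_of_support_subset (s := tsupport φ)]
  · exact h2
  · intro x hx
    exact subset_tsupport φ (right_ne_zero_of_mul hx)

theorem integrable (hφ : HalfTest φ) : Integrable φ :=
  hφ.smooth.continuous.integrable_of_hasCompactSupport hφ.compact

theorem integral_eq {a b : ℝ} (hs : tsupport φ ⊆ Set.Ioo a b) (w : ℝ → ℝ) :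
    ∫ x, w x * φ x = ∫ x in a..b, w x * φ x := by
  refine (intervalIntegral.integral_eq_integral_of_support_subset fun x hx => ?_).symm
  have := hs (subset_tsupport φ (right_ne_zero_of_mul hx))
  exact ⟨this.1, this.2.le⟩

/-- A test function with integral zero is the derivative of a test function. -/
theorem exists_primitive (hφ : HalfTest φ) (h0 : ∫ x, φ x = 0) :
    ∃ ψ, HalfTest ψ ∧ _root_.deriv ψ = φ := by
  obtain ⟨a, b, ha, ha1, hb1, hs⟩ := hφ.exists_bounds
  have hz : ∀ x, x ∉ Set.Ioo a b → φ x = 0 := fun x hx => by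
    by_contra h
    exact hx (hs (subset_tsupport φ h))
  have hc := hφ.smooth.continuous
  set ψ : ℝ → ℝ := fun x => ∫ t in a..x, φ t with hψ
  have hd : ∀ x, HasDerivAt ψ (φ x) x := fun x => hc.integral_hasStrictDerivAt a x |>.hasDerivAt
  have hde : _root_.deriv ψ = φ := funext fun x => (hd x).deriv
  have hsupp : tsupport ψ ⊆ Set.Icc a b := by
    refine closure_minimal (fun x hx => ?_) isClosed_Icc
    by_contra hx'
    refine hx ?_
    rcases le_or_gt a x with h | h
    · have hxb : b < x := by by_contra! h'; exact hx' ⟨h, h'⟩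
      -- To the right of the support the primitive equals the full integral, which vanishes by
      -- hypothesis.
      have h1 : ∫ t in a..x, φ t = ∫ t, φ t := by
        refine intervalIntegral.integral_eq_integral_of_support_subset fun t ht => ?_
        have := hs (subset_tsupport φ ht)
        exact ⟨this.1, by linarith [this.2]⟩
      simp only [hψ, h1, h0]
    · have h1 : ∫ t in a..x, φ t = ∫ t in a..x, (0 : ℝ) := by
        refine intervalIntegral.integral_congr fun t ht => ?_
        rw [Set.uIcc_of_ge h.le] at ht
        exact hz t fun h' => by linarith [h'.1, ht.2]
      simp only [hψ, h1]; simp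
  refine ⟨ψ, ⟨?_, ?_, ?_⟩, hde⟩
  · rw [contDiff_infty_iff_deriv, hde]
    exact ⟨fun x => (hd x).differentiableAt, hφ.smooth⟩
  · exact HasCompactSupport.of_support_subset_isCompact isCompact_Icc
      ((subset_tsupport ψ).trans hsupp)
  · exact fun x hx => ha.trans_le (hsupp hx).1

/-- A reference function of mass one: subtracting $(\int\varphi)\eta$ from $\varphi$ leaves a
function with a test primitive. -/
theorem exists_integral_eq_one : ∃ η, HalfTest η ∧ ∫ x, η x = 1 := by
  let f : ContDiffBump (2 : ℝ) := ⟨1 / 2, 1, by norm_num, by norm_num⟩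
  refine ⟨f.normed volume, ⟨f.contDiff_normed, f.hasCompactSupport_normed, ?_⟩,
    f.integral_normed⟩
  rw [f.tsupport_normed_eq]
  intro x hx
  rw [Metric.mem_closedBall, Real.dist_eq] at hx
  have : |x - 2| ≤ 1 := hx
  have := (abs_le.1 this).1
  exact Set.mem_Ioi.2 (by linarith)

end HalfTest

theorem continuousOn_Ioi_locallyIntegrableOn {g : ℝ → ℝ} (hg : ContinuousOn g (Set.Ioi 0)) :
    LocallyIntegrableOn g (Set.Ioi 0) :=
  hg.locallyIntegrableOn measurableSet_Ioi

/-- The lemma of du Bois-Reymond. -/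
theorem ae_eq_const_of_integral_mul_deriv {w : ℝ → ℝ} (hw : LocallyIntegrableOn w (Set.Ioi 0))
    (h : ∀ φ, HalfTest φ → ∫ x, w x * deriv φ x = 0) :
    ∃ C, ∀ᵐ x, 0 < x → w x = C := by
  obtain ⟨η, hη, hη1⟩ := HalfTest.exists_integral_eq_one
  set C := ∫ x, w x * η x with hC
  refine ⟨C, ?_⟩
  have key := IsOpen.ae_eq_zero_of_integral_contDiff_smul_eq_zero (μ := volume)
    (f := fun x => w x - C) isOpen_Ioi
    (hw.sub (locallyIntegrableOn_const C)) fun g hg1 hg2 hg3 => ?_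
  · filter_upwards [key] with x hx hx0 using sub_eq_zero.1 (hx hx0)
  have hg : HalfTest g := ⟨hg1, hg2, hg3⟩
  obtain ⟨ψ, hψ, hde⟩ := (hg.sub (hη.const_mul (∫ x, g x))).exists_primitive (by
    rw [integral_sub hg.integrable (hη.const_mul _).integrable, integral_const_mul, hη1]; ring)
  have h1 := h ψ hψ
  rw [hde] at h1
  have i1 := hg.integrable_mul hw
  have i2 := (hη.const_mul (∫ x, g x)).integrable_mul hw
  simp_rw [mul_sub] at h1
  rw [integral_sub i1 i2] at h1
  have h2 : ∫ x, w x * ((∫ x, g x) * η x) = (∫ x, g x) * C := by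
    rw [hC, ← integral_const_mul]; congr 1; ext x; ring
  have h3 : ∀ x, g x • (w x - C) = w x * g x - C * g x := fun x => by simp; ring
  simp_rw [h3]
  rw [integral_sub i1 (hg.integrable.const_mul C), integral_const_mul]
  linarith

/-- Take $\psi$ with $\psi'=\varphi-(\int\varphi)\eta$ as test function. Then $\int
w\varphi'=D\int\varphi=-D\int x\varphi'$, so $w+Dx$ has zero weak derivative and du Bois-Reymond
applies. -/
theorem ae_eq_affine_of_integral_mul_deriv_deriv {w : ℝ → ℝ}
    (hw : LocallyIntegrableOn w (Set.Ioi 0))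
    (h : ∀ φ, HalfTest φ → ∫ x, w x * deriv (deriv φ) x = 0) :
    ∃ C D, ∀ᵐ x, 0 < x → w x = C + D * x := by
  obtain ⟨η, hη, hη1⟩ := HalfTest.exists_integral_eq_one
  set D := ∫ x, w x * deriv η x with hD
  have hl : LocallyIntegrableOn (fun x : ℝ => D * x) (Set.Ioi 0) :=
    continuousOn_Ioi_locallyIntegrableOn (by fun_prop)
  suffices key : ∀ φ, HalfTest φ → ∫ x, (w x + D * x) * deriv φ x = 0 by
    obtain ⟨C, hC⟩ := ae_eq_const_of_integral_mul_deriv (hw.add hl) key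
    refine ⟨C, -D, ?_⟩
    filter_upwards [hC] with x hx hx0
    have : w x + D * x = C := hx hx0
    linarith
  intro φ hφ
  obtain ⟨ψ, hψ, hde⟩ := (hφ.sub (hη.const_mul (∫ x, φ x))).exists_primitive (by
    rw [integral_sub hφ.integrable (hη.const_mul _).integrable, integral_const_mul, hη1]; ring)
  have h1 := h ψ hψ
  have h2 : ∀ x, deriv (deriv ψ) x = deriv φ x - (∫ x, φ x) * deriv η x := fun x => by
    rw [hde]
    exact ((hφ.hasDerivAt x).sub ((hη.hasDerivAt x).const_mul _)).deriv
  simp_rw [h2, mul_sub] at h1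
  have i1 := hφ.deriv.integrable_mul hw
  have i2 := (hη.deriv.const_mul (∫ x, φ x)).integrable_mul hw
  rw [integral_sub i1 i2] at h1
  have h3 : ∫ x, w x * ((∫ x, φ x) * deriv η x) = (∫ x, φ x) * D := by
    rw [hD, ← integral_const_mul]; congr 1; ext x; ring
  have h4 : ∫ x : ℝ, x * deriv φ x = - ∫ x, φ x := by
    have i3 : Integrable (fun x : ℝ => x * deriv φ x) :=
      hφ.deriv.integrable_mul (continuousOn_Ioi_locallyIntegrableOn continuousOn_id)
    have i4 : Integrable (fun x : ℝ => x * φ x) :=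
      hφ.integrable_mul (continuousOn_Ioi_locallyIntegrableOn continuousOn_id)
    have := integral_eq_zero_of_hasDerivAt_of_integrable (f := fun x : ℝ => x * φ x)
      (f' := fun x => 1 * φ x + x * deriv φ x)
      (fun x => (hasDerivAt_id x).mul (hφ.hasDerivAt x))
      ((hφ.integrable.const_mul 1).add i3) i4
    rw [integral_add (hφ.integrable.const_mul 1) i3] at this
    simp only [one_mul] at this
    linarith
  have h5 : ∀ x, (w x + D * x) * deriv φ x = w x * deriv φ x + D * (x * deriv φ x) :=
    fun x => by ring
  simp_rw [h5]
  have i3 : Integrable (fun x : ℝ => x * deriv φ x) :=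
      hφ.deriv.integrable_mul (continuousOn_Ioi_locallyIntegrableOn continuousOn_id)
  rw [integral_add i1 (i3.const_mul D), integral_const_mul, h4]
  linarith

theorem intervalIntegrable_of_locallyIntegrableOn {f : ℝ → ℝ}
    (hf : LocallyIntegrableOn f (Set.Ioi 0)) {a b : ℝ} (ha : 0 < a) (hb : 0 < b) :
    IntervalIntegrable f volume a b := by
  rw [intervalIntegrable_iff]
  refine (hf.integrableOn_compact_subset (t := Set.uIcc a b) (fun x hx => ?_) isCompact_uIcc).mono_set
    Set.uIoc_subset_uIcc
  exact lt_of_lt_of_le (lt_min ha hb) hx.1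

/-- Integration by parts against a test function. -/
theorem integral_mul_eq_neg_integral_primitive {f : ℝ → ℝ}
    (hf : LocallyIntegrableOn f (Set.Ioi 0)) {φ : ℝ → ℝ} (hφ : HalfTest φ) :
    ∫ x, f x * φ x = - ∫ x, (∫ t in (1 : ℝ)..x, f t) * deriv φ x := by
  obtain ⟨a, b, ha, ha1, hb1, hs⟩ := hφ.exists_bounds
  have hab : a ≤ b := by linarith
  have hz : ∀ x, x ∉ Set.Ioo a b → φ x = 0 := fun x hx => by
    by_contra h
    exact hx (hs (subset_tsupport φ h))
  have hfi := intervalIntegrable_of_locallyIntegrableOn hf ha (by linarith : 0 < b)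
  have h1m : (1 : ℝ) ∈ Set.uIcc a b := by rw [Set.uIcc_of_le hab]; exact ⟨ha1.le, hb1.le⟩
  -- As `f` is only locally integrable, its primitive is merely absolutely continuous, with
  -- derivative `f` almost everywhere; this suffices for integration by parts.
  have hQ := hfi.absolutelyContinuousOnInterval_intervalIntegral h1m
  have hP : AbsolutelyContinuousOnInterval φ a b :=
    (hφ.smooth.of_le (by simp)).contDiffOn.absolutelyContinuousOnInterval
  have hbp := hQ.integral_mul_deriv_eq_deriv_mul hP
  rw [hz a (by simp), hz b (by simp)] at hbp
  rw [HalfTest.integral_eq hs, HalfTest.integral_eq (tsupport_deriv_subset.trans hs), hbp]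
  simp only [mul_zero, sub_zero, zero_sub, neg_neg]
  refine intervalIntegral.integral_congr_ae ?_
  filter_upwards [hfi.ae_hasDerivAt_integral] with x hx hxm
  rw [(hx (Set.uIoc_subset_uIcc hxm) 1 h1m).deriv]

theorem hasDerivAt_primitive {f : ℝ → ℝ} (hf : ContinuousOn f (Set.Ioi 0)) {x : ℝ} (hx : 0 < x) :
    HasDerivAt (fun x => ∫ t in (1 : ℝ)..x, f t) (f x) x := by
  refine intervalIntegral.integral_hasDerivAt_right
    (intervalIntegrable_of_locallyIntegrableOn (continuousOn_Ioi_locallyIntegrableOn hf) one_pos hx)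
    (hf.stronglyMeasurableAtFilter isOpen_Ioi x hx) (hf.continuousAt (isOpen_Ioi.mem_nhds hx))

/-- A locally integrable weak solution of `u'' = q u` is a classical solution. -/
theorem exists_classical_of_weak {q u : ℝ → ℝ} (hq : ContinuousOn q (Set.Ioi 0))
    (hu : LocallyIntegrableOn u (Set.Ioi 0))
    (h : ∀ φ, HalfTest φ → ∫ x, u x * (deriv (deriv φ) x - q x * φ x) = 0) :
    ∃ v v' : ℝ → ℝ, (∀ x, 0 < x → HasDerivAt v (v' x) x) ∧
      (∀ x, 0 < x → HasDerivAt v' (q x * v x) x) ∧ ∀ᵐ x, 0 < x → u x = v x := by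
  have hf : LocallyIntegrableOn (fun x => q x * u x) (Set.Ioi 0) :=
    hu.continuousOn_mul hq isOpen_Ioi.isLocallyClosed
  set Q : ℝ → ℝ := fun x => ∫ t in (1 : ℝ)..x, q t * u t with hQdef
  -- The double primitive of $qu$. The weak equation says that $u-G$ has vanishing second weak
  -- derivative, so it is affine.
  set G : ℝ → ℝ := fun x => ∫ t in (1 : ℝ)..x, Q t with hGdef
  have hQc : ContinuousOn Q (Set.Ioi 0) := by
    intro x hx
    have hx0 : (0 : ℝ) < x := hx
    have hm : (1 : ℝ) ∈ Set.uIcc (min x 1 / 2) (max x 1 + 1) := by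
      rw [Set.mem_uIcc]; left
      constructor
      · linarith [min_le_right x 1]
      · linarith [le_max_right x 1]
    have hp : 0 < min x 1 := lt_min hx0 one_pos
    have h1 := (intervalIntegrable_of_locallyIntegrableOn hf (a := min x 1 / 2) (b := max x 1 + 1)
      (by linarith) (by linarith [le_max_right x 1])).absolutelyContinuousOnInterval_intervalIntegral
      hm |>.continuousOn
    refine (h1.continuousAt ?_).continuousWithinAt
    rw [Set.uIcc_of_le (by linarith [min_le_right x 1, le_max_right x 1])]
    exact Icc_mem_nhds (by linarith [min_le_left x 1]) (by linarith [le_max_left x 1])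
  have hGd : ∀ x, 0 < x → HasDerivAt G (Q x) x := fun x hx => hasDerivAt_primitive hQc hx
  have hGc : ContinuousOn G (Set.Ioi 0) := fun x hx => (hGd x hx).continuousAt.continuousWithinAt
  have hGl := continuousOn_Ioi_locallyIntegrableOn hGc
  obtain ⟨C, D, hCD⟩ := ae_eq_affine_of_integral_mul_deriv_deriv (w := fun x => u x - G x)
    (hu.sub hGl) fun φ hφ => by
      have h1 := h φ hφ
      have i1 := hφ.deriv.deriv.integrable_mul hu
      have i2 := hφ.integrable_mul hf
      have e1 : ∀ x, u x * (deriv (deriv φ) x - q x * φ x)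
          = u x * deriv (deriv φ) x - q x * u x * φ x := fun x => by ring
      simp_rw [e1] at h1
      rw [integral_sub i1 i2, integral_mul_eq_neg_integral_primitive hf hφ,
        integral_mul_eq_neg_integral_primitive (continuousOn_Ioi_locallyIntegrableOn hQc)
          hφ.deriv] at h1
      simp_rw [sub_mul]
      rw [integral_sub i1 (hφ.deriv.deriv.integrable_mul hGl)]
      linarith
  refine ⟨fun x => G x + (C + D * x), fun x => Q x + D, fun x hx => ?_, fun x hx => ?_, ?_⟩
  · refine ((hGd x hx).add (((hasDerivAt_id x).const_mul D).const_add C)).congr_deriv (by ring)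
  · have hae : ∀ᵐ x, 0 < x → u x = G x + (C + D * x) := by
      filter_upwards [hCD] with y hy hy0
      linarith [hy hy0]
    have hc : ContinuousOn (fun x => q x * (G x + (C + D * x))) (Set.Ioi 0) :=
      hq.mul (hGc.add (by fun_prop))
    -- The bootstrap: $u$ may be replaced under the integral by its continuous representative, after
    -- which `Q` is differentiable at every point.
    have heq : ∀ y, 0 < y → Q y = ∫ t in (1 : ℝ)..y, q t * (G t + (C + D * t)) := fun y hy => by
      refine intervalIntegral.integral_congr_ae ?_
      filter_upwards [hae] with t ht htm
      rw [ht (lt_of_le_of_lt (le_min zero_le_one hy.le) htm.1)]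
    have h1 := (hasDerivAt_primitive hc hx).congr_of_eventuallyEq
      (Filter.eventually_of_mem (Ioi_mem_nhds hx) heq)
    exact h1.add_const D
  · filter_upwards [hCD] with y hy hy0
    linarith [hy hy0]

/-- In the limit point case, the only square integrable weak solution of `u'' = q u` is zero. -/
theorem ae_eq_zero_of_weak {s : ℝ} (hs : 1 / 2 ≤ s) {q u : ℝ → ℝ}
    (hq : ContinuousOn q (Set.Ioi 0)) (hqs : ∀ x, 0 < x → s * (s + 1) / x ^ 2 ≤ q x)
    (hu : MemLp u 2 (volume.restrict (Set.Ioi 0)))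
    (h : ∀ φ, HalfTest φ → ∫ x, u x * (deriv (deriv φ) x - q x * φ x) = 0) :
    ∀ᵐ x, 0 < x → u x = 0 := by
  have hul : LocallyIntegrableOn u (Set.Ioi 0) :=
    locallyIntegrableOn_of_locallyIntegrable_restrict (hu.locallyIntegrable (by norm_num))
  obtain ⟨v, v', hv, hv', huv⟩ := exists_classical_of_weak hq hul h
  have hL : IntegrableOn (fun x => v x ^ 2) (Set.Ioi 0) := by
    refine hu.integrable_sq.congr ?_
    refine (ae_restrict_iff' measurableSet_Ioi).2 ?_
    filter_upwards [huv] with x hx hx0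
    simp only [hx hx0]
  filter_upwards [huv] with x hx hx0
  rw [hx hx0, eq_zero_of_ode hs hqs hv hv' hL hx0]

/-! ### Calculus of test functions -/

theorem hasDerivAt_cover_snd {f : Cyl → ℂ} (hf : IsTest f) (x t : ℝ) :
    HasDerivAt (fun t : ℝ => f (cover (x, t))) (dy f (cover (x, t))) t := by
  rw [dy_cover hf]
  have h := ((hf.smooth.differentiable (by simp)) (x, t)).hasFDerivAt
  have h2 : HasDerivAt (fun t : ℝ => ((x, t) : ℝ × ℝ)) (0, 1) t :=
    (hasDerivAt_const t x).prodMk (hasDerivAt_id t)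
  exact HasFDerivAt.comp_hasDerivAt (x := t) (l := fun q : ℝ × ℝ => f (cover q)) h h2

theorem IsTest.hasDerivAt_x {f : Cyl → ℂ} (hf : IsTest f) (p : Cyl) :
    HasDerivAt (fun s : ℝ => f (s, p.2)) (AlphaGrushin.dx f p) p.1 := by
  obtain ⟨q, rfl⟩ := isOpenQuotientMap_cover.surjective p
  rw [dx_cover hf]
  exact hasDerivAt_dx hf q

theorem IsTest.hasDerivAt_y {f : Cyl → ℂ} (hf : IsTest f) (p : Cyl) :
    HasDerivAt (fun t : ℝ => f (p.1, p.2 + (t : AddCircle (2 * Real.pi)))) (AlphaGrushin.dy f p) 0 := by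
  obtain ⟨q, rfl⟩ := isOpenQuotientMap_cover.surjective p
  rw [dy_cover hf]
  exact hasDerivAt_dy hf q

theorem IsTest.integrable {f : Cyl → ℂ} (hf : IsTest f) : Integrable f :=
  hf.continuous.integrable_of_hasCompactSupport hf.compact

theorem IsTest.memLp {f : Cyl → ℂ} (hf : IsTest f) : MemLp f 2 (volume : Measure Cyl) :=
  memLp_volume ⟨f, hf⟩

theorem IsTest.add {f g : Cyl → ℂ} (hf : IsTest f) (hg : IsTest g) : IsTest (fun p => f p + g p) :=
  testSpace.add_mem hf hg

theorem IsTest.sub {f g : Cyl → ℂ} (hf : IsTest f) (hg : IsTest g) : IsTest (fun p => f p - g p) :=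
  testSpace.sub_mem hf hg

theorem IsTest.smoothOff {f : Cyl → ℂ} (hf : IsTest f) : SmoothOff f := hf.smooth.contDiffOn

theorem IsTest.conj {f : Cyl → ℂ} (hf : IsTest f) : IsTest (fun p => starRingEnd ℂ (f p)) :=
  hf.of_tsupport (Complex.conjCLE.contDiff.comp hf.smooth) fun p hp => by
    refine subset_tsupport _ fun h => hp ?_
    simp [h]

/-- The integral of an `x`-derivative vanishes. -/
theorem IsTest.integral_dx {f : Cyl → ℂ} (hf : IsTest f) : ∫ p, AlphaGrushin.dx f p = 0 := by
  have hi := hf.dx.integrable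
  rw [Measure.volume_eq_prod] at hi ⊢
  rw [integral_prod_symm _ hi]
  refine integral_eq_zero_of_ae (Filter.Eventually.of_forall fun y => ?_)
  have hemb : Topology.IsClosedEmbedding (fun x : ℝ => ((x, y) : Cyl)) :=
    Topology.IsClosedEmbedding.of_continuous_injective_isClosedMap (by fun_prop)
      (fun a b h => congrArg Prod.fst h) (isClosedMap_prodMk_right y)
  have hint : ∀ {g : Cyl → ℂ}, IsTest g → Integrable (fun x : ℝ => g (x, y)) := fun {g} hg =>
    (hg.continuous.comp hemb.continuous).integrable_of_hasCompactSupport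
      (hg.compact.comp_isClosedEmbedding hemb)
  exact integral_eq_zero_of_hasDerivAt_of_integrable (fun x => hf.hasDerivAt_x (x, y))
    (hint hf.dx) (hint hf)

/-- The integral of a `y`-derivative vanishes. -/
theorem IsTest.integral_dy {f : Cyl → ℂ} (hf : IsTest f) : ∫ p, AlphaGrushin.dy f p = 0 := by
  have hi := hf.dy.integrable
  rw [Measure.volume_eq_prod] at hi ⊢
  rw [integral_prod _ hi]
  refine integral_eq_zero_of_ae (Filter.Eventually.of_forall fun x => ?_)
  have h1 := AddCircle.intervalIntegral_preimage (2 * Real.pi) 0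
    (fun y => AlphaGrushin.dy f (x, y))
  simp only [Pi.zero_apply]
  rw [← h1]
  have h2 : ∀ t ∈ Set.uIcc (0 : ℝ) (0 + 2 * Real.pi),
      HasDerivAt (fun t : ℝ => f (cover (x, t))) (AlphaGrushin.dy f (cover (x, t))) t :=
    fun t _ => hasDerivAt_cover_snd hf x t
  have hc : Continuous fun t : ℝ => AlphaGrushin.dy f (cover (x, t)) :=
    hf.dy.continuous.comp (continuous_cover.comp (by fun_prop))
  have h3 := intervalIntegral.integral_eq_sub_of_hasDerivAt h2 (hc.intervalIntegrable _ _)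
  refine h3.trans ?_
  have h4 : cover (x, 0 + 2 * Real.pi) = cover (x, 0) := by
    simp [cover, AddCircle.coe_period]
  rw [h4, sub_self]

theorem dx_conj {f : Cyl → ℂ} (hf : IsTest f) (p : Cyl) :
    dx (fun p => starRingEnd ℂ (f p)) p = starRingEnd ℂ (dx f p) :=
  (Complex.conjCLE.hasFDerivAt.comp_hasDerivAt p.1 (hf.hasDerivAt_x p)).deriv

theorem dy_conj {f : Cyl → ℂ} (hf : IsTest f) (p : Cyl) :
    dy (fun p => starRingEnd ℂ (f p)) p = starRingEnd ℂ (dy f p) :=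
  (Complex.conjCLE.hasFDerivAt.comp_hasDerivAt (0 : ℝ) (hf.hasDerivAt_y p)).deriv

theorem dx_mul {f g : Cyl → ℂ} (hf : IsTest f) (hg : IsTest g) (p : Cyl) :
    dx (fun p => f p * g p) p = dx f p * g p + f p * dx g p :=
  ((hf.hasDerivAt_x p).mul (hg.hasDerivAt_x p)).deriv

theorem dy_mul {f g : Cyl → ℂ} (hf : IsTest f) (hg : IsTest g) (p : Cyl) :
    dy (fun p => f p * g p) p = dy f p * g p + f p * dy g p := by
  refine ((hf.hasDerivAt_y p).mul (hg.hasDerivAt_y p)).deriv.trans ?_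
  simp

/-- A function of `x` alone passes through `∂_y`. -/
theorem dy_coeff_mul (c : ℝ → ℂ) (f : Cyl → ℂ) (p : Cyl) :
    dy (fun p => c p.1 * f p) p = c p.1 * dy f p :=
  deriv_const_mul_field (c p.1)

/-- The coefficient of the zeroth order term of the transformed operator. -/
def potential (α : ℝ) (p : Cyl) : ℂ := ((α / 2 * (α / 2 + 1) / p.1 ^ 2 : ℝ) : ℂ)

/-- The coefficient of `∂_y²`. -/
def weight (α : ℝ) (p : Cyl) : ℂ := ((|p.1| ^ (2 * α) : ℝ) : ℂ)

theorem smoothOff_potential (α : ℝ) : SmoothOff (potential α) :=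
  smoothOff_ofReal (φ := fun x => α / 2 * (α / 2 + 1) / x ^ 2)
    (fun x hx => by
      have h : x ^ 2 ≠ 0 := pow_ne_zero 2 hx
      fun_prop (disch := assumption)) fun _ _ => rfl

theorem smoothOff_weight (α : ℝ) : SmoothOff (weight α) :=
  smoothOff_ofReal (contDiffAt_abs_rpow (2 * α)) fun _ _ => rfl

theorem isTest_transformed (α : ℝ) {f : Cyl → ℂ} (hf : IsTest f) :
    IsTest (transformedLaplacian α f) := (transformedLin α ⟨f, hf⟩).2

/-- The integrand of the Dirichlet form. -/
def formDensity (α : ℝ) (f g : Cyl → ℂ) (p : Cyl) : ℂ :=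
  dx g p * starRingEnd ℂ (dx f p) + potential α p * (g p * starRingEnd ℂ (f p)) +
    weight α p * (dy g p * starRingEnd ℂ (dy f p))

/-- The sum of the two integrands is $\partial_x(g_x\bar f)+\partial_y(|x|^{2\alpha}g_y\bar f)$, a
divergence of test functions; there is no boundary term because supports avoid $x=0$. -/
theorem integral_mul_transformed (α : ℝ) {f g : Cyl → ℂ} (hf : IsTest f) (hg : IsTest g) :
    ∫ p, transformedLaplacian α g p * starRingEnd ℂ (f p) = - ∫ p, formDensity α f g p := by
  have t1 : IsTest (fun p => dx g p * starRingEnd ℂ (f p)) := hf.conj.mul hg.dx.smoothOff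
  have t2 : IsTest (fun p => dy g p * starRingEnd ℂ (f p)) := hf.conj.mul hg.dy.smoothOff
  have t2' : IsTest (fun p => weight α p * (dy g p * starRingEnd ℂ (f p))) :=
    t2.mul (smoothOff_weight α)
  have t3 : IsTest (fun p => transformedLaplacian α g p * starRingEnd ℂ (f p)) :=
    hf.conj.mul (isTest_transformed α hg).smoothOff
  have t4 : IsTest (formDensity α f g) :=
    ((hf.dx.conj.mul hg.dx.smoothOff).add
      ((hf.conj.mul hg.smoothOff).mul (smoothOff_potential α))).add
      ((hf.dy.conj.mul hg.dy.smoothOff).mul (smoothOff_weight α))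
  have key : ∀ p, transformedLaplacian α g p * starRingEnd ℂ (f p) + formDensity α f g p =
      dx (fun p => dx g p * starRingEnd ℂ (f p)) p +
        dy (fun p => weight α p * (dy g p * starRingEnd ℂ (f p))) p := fun p => by
    have e1 : dy (fun p => weight α p * (dy g p * starRingEnd ℂ (f p))) p =
        weight α p * dy (fun p => dy g p * starRingEnd ℂ (f p)) p :=
      dy_coeff_mul (fun x => ((|x| ^ (2 * α) : ℝ) : ℂ)) _ p
    rw [e1, dx_mul hg.dx hf.conj, dy_mul hg.dy hf.conj, dx_conj hf, dy_conj hf]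
    simp only [transformedLaplacian, formDensity, potential, weight]
    ring
  have h := integral_add t3.integrable t4.integrable
  have h0 : ∫ p, (transformedLaplacian α g p * starRingEnd ℂ (f p) + formDensity α f g p) = 0 := by
    simp_rw [key]
    rw [integral_add t1.dx.integrable t2'.dy.integrable, t1.integral_dx, t2'.integral_dy, add_zero]
  rw [h0] at h
  linear_combination -h

/-! ### Inner products and graphs -/

theorem inner_toLp {μ : Measure Cyl} {f g : Cyl → ℂ} (hf : MemLp f 2 μ) (hg : MemLp g 2 μ) :
    inner ℂ (hf.toLp f) (hg.toLp g) = ∫ p, g p * starRingEnd ℂ (f p) ∂μ := by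
  rw [L2.inner_def]
  refine integral_congr_ae ?_
  filter_upwards [hf.coeFn_toLp, hg.coeFn_toLp] with p h1 h2
  rw [h1, h2]; rfl

theorem inner_toLp_right {μ : Measure Cyl} (u : Lp ℂ 2 μ) {g : Cyl → ℂ} (hg : MemLp g 2 μ) :
    inner ℂ u (hg.toLp g) = ∫ p, g p * starRingEnd ℂ (u p) ∂μ := by
  rw [L2.inner_def]
  refine integral_congr_ae ?_
  filter_upwards [hg.coeFn_toLp] with p h2
  rw [h2]; rfl

/-- This removes the inverse of the embedding into $L^2$ from view: later arguments use only pairs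
$(f,Tf)$ with $f$ a test function. -/
theorem mem_graph_testOperator {μ : Measure Cyl} {hfin : ∀ f : testSpace, MemLp (f : Cyl → ℂ) 2 μ}
    {hac : volume ≪ μ} {T : testSpace →ₗ[ℂ] testSpace} {p : Lp ℂ 2 μ × Lp ℂ 2 μ} :
    p ∈ (testOperator μ hfin hac T).graph ↔ ∃ f, toL2 μ hfin f = p.1 ∧ toL2 μ hfin (T f) = p.2 := by
  rw [LinearPMap.mem_graph_iff]
  constructor
  · rintro ⟨⟨x, hx⟩, h1, h2⟩
    obtain ⟨f, rfl⟩ := hx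
    refine ⟨f, h1, ?_⟩
    rw [← h2]
    change _ = toL2 μ hfin (T ((LinearEquiv.ofInjective (toL2 μ hfin) _).symm _))
    congr 2
    exact ((LinearEquiv.ofInjective (toL2 μ hfin)
      (toL2_injective μ hfin hac)).symm_apply_apply f).symm
  · rintro ⟨f, h1, h2⟩
    refine ⟨⟨toL2 μ hfin f, f, rfl⟩, h1, ?_⟩
    rw [← h2]
    change toL2 μ hfin (T ((LinearEquiv.ofInjective (toL2 μ hfin) _).symm _)) = _
    congr 2
    exact ((LinearEquiv.ofInjective (toL2 μ hfin)
      (toL2_injective μ hfin hac)).symm_apply_apply f)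

theorem mem_graph_transformedOp {α : ℝ}
    {p : Lp ℂ 2 (volume : Measure Cyl) × Lp ℂ 2 (volume : Measure Cyl)} :
    p ∈ (transformedOp α).graph ↔ ∃ f : testSpace, f.2.memLp.toLp f = p.1 ∧
      (isTest_transformed α f.2).memLp.toLp (transformedLaplacian α f) = p.2 :=
  mem_graph_testOperator

theorem IsTest.mem_graph_transformedOp (α : ℝ) {f : Cyl → ℂ} (hf : IsTest f) :
    (hf.memLp.toLp f, (isTest_transformed α hf).memLp.toLp _) ∈ (transformedOp α).graph :=
  AlphaGrushin.mem_graph_transformedOp.2 ⟨⟨f, hf⟩, rfl, rfl⟩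

/-- The Dirichlet form is Hermitian because its coefficients are real. -/
theorem transformedOp_symmetric (α : ℝ) : ∀ p ∈ (transformedOp α).graph,
    ∀ q ∈ (transformedOp α).graph, inner ℂ p.1 q.2 = inner ℂ p.2 q.1 := by
  intro p hp q hq
  obtain ⟨f, h1, h2⟩ := mem_graph_transformedOp.1 hp
  obtain ⟨g, h3, h4⟩ := mem_graph_transformedOp.1 hq
  rw [← inner_conj_symm p.2 q.1, ← h1, ← h2, ← h3, ← h4, inner_toLp, inner_toLp,
    integral_mul_transformed α f.2 g.2, integral_mul_transformed α g.2 f.2, map_neg,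
    ← integral_conj]
  congr 1
  refine integral_congr_ae (Filter.Eventually.of_forall fun p => ?_)
  simp only [formDensity, potential, weight, map_add, map_mul, Complex.conj_conj,
    Complex.conj_ofReal]
  ring

theorem transformedOp_nonpos {α : ℝ} (hα : 0 < α) : ∀ p ∈ (transformedOp α).graph,
    (inner ℂ p.1 p.2).re ≤ 0 := by
  intro p hp
  obtain ⟨f, h1, h2⟩ := mem_graph_transformedOp.1 hp
  rw [← h1, ← h2, inner_toLp, integral_mul_transformed α f.2 f.2]
  have h : ∀ p, formDensity α f f p = ((Complex.normSq (dx f p) +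
      α / 2 * (α / 2 + 1) / p.1 ^ 2 * Complex.normSq ((f : Cyl → ℂ) p) +
      |p.1| ^ (2 * α) * Complex.normSq (dy f p) : ℝ) : ℂ) := fun p => by
    simp only [formDensity, potential, weight, Complex.mul_conj]
    push_cast; ring
  simp_rw [h]
  rw [integral_complex_ofReal, Complex.neg_re, Complex.ofReal_re, neg_nonpos]
  refine integral_nonneg fun p => ?_
  have a1 := Complex.normSq_nonneg (dx f p)
  have a2 := Complex.normSq_nonneg (dy f p)
  have a3 := Complex.normSq_nonneg ((f : Cyl → ℂ) p)
  simp only [Pi.zero_apply]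
  positivity

/-! ### Fourier coefficients in `y` -/

/-- Cauchy-Schwarz for integrals. -/
theorem sq_norm_integral_mul_conj_le {X : Type*} [MeasurableSpace X] {μ : Measure X} {f g : X → ℂ}
    (hf : MemLp f 2 μ) (hg : MemLp g 2 μ) :
    ‖∫ p, g p * starRingEnd ℂ (f p) ∂μ‖ ^ 2 ≤ (∫ p, ‖f p‖ ^ 2 ∂μ) * ∫ p, ‖g p‖ ^ 2 ∂μ := by
  have hin : ∀ {f g : X → ℂ} (hf : MemLp f 2 μ) (hg : MemLp g 2 μ),
      inner ℂ (hf.toLp f) (hg.toLp g) = ∫ p, g p * starRingEnd ℂ (f p) ∂μ := fun {f g} hf hg => by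
    rw [L2.inner_def]
    refine integral_congr_ae ?_
    filter_upwards [hf.coeFn_toLp, hg.coeFn_toLp] with p h1 h2
    rw [h1, h2]; rfl
  have hno : ∀ {f : X → ℂ} (hf : MemLp f 2 μ), ‖hf.toLp f‖ ^ 2 = ∫ p, ‖f p‖ ^ 2 ∂μ :=
    fun {f} hf => by
      have h1 : (inner ℂ (hf.toLp f) (hf.toLp f)).re = ‖hf.toLp f‖ ^ 2 := by
        simpa using inner_self_eq_norm_sq (𝕜 := ℂ) (hf.toLp f)
      rw [← h1, hin hf hf]
      have h2 : ∀ p, f p * starRingEnd ℂ (f p) = ((‖f p‖ ^ 2 : ℝ) : ℂ) := fun p => by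
        rw [Complex.mul_conj, Complex.normSq_eq_norm_sq]
      simp_rw [h2]
      rw [integral_complex_ofReal, Complex.ofReal_re]
  rw [← hin hf hg, ← hno hf, ← hno hg, ← mul_pow]
  exact pow_le_pow_left₀ (norm_nonneg _) (norm_inner_le_norm _ _) 2

/-- The (conjugate, unnormalized) Fourier coefficients in `y` of a function on the cylinder. -/
def yCoeff (u : Cyl → ℂ) (k : ℤ) (x : ℝ) : ℂ :=
  ∫ y : AddCircle (2 * Real.pi), fourier k y * starRingEnd ℂ (u (x, y))

theorem memLp_fourier (k : ℤ) :
    MemLp (fun y : AddCircle (2 * Real.pi) => (fourier k y : ℂ)) 2 volume :=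
  (fourier k).continuous.memLp_of_hasCompactSupport (HasCompactSupport.of_compactSpace _)

theorem ae_memLp_slice {u : Cyl → ℂ} (hu : MemLp u 2 volume) :
    ∀ᵐ x : ℝ, MemLp (fun y => u (x, y)) 2 volume := by
  have h1 := hu.aestronglyMeasurable
  have h2 := (memLp_two_iff_integrable_sq_norm h1).1 hu
  rw [Measure.volume_eq_prod] at h1 h2
  filter_upwards [h1.prodMk_left, h2.prod_right_ae] with x hx1 hx2
  exact (memLp_two_iff_integrable_sq_norm hx1).2 hx2

/-- Cauchy-Schwarz on each circle bounds the squared coefficient by a constant times the slice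
integral of $|u|^2$, which Fubini makes integrable in $x$. -/
theorem memLp_yCoeff {u : Cyl → ℂ} (hu : MemLp u 2 volume) (k : ℤ) :
    MemLp (yCoeff u k) 2 volume := by
  have hm : AEStronglyMeasurable (yCoeff u k) volume := by
    have h1 : AEStronglyMeasurable (fun p : Cyl => fourier k p.2 * starRingEnd ℂ (u p))
        ((volume : Measure ℝ).prod (volume : Measure (AddCircle (2 * Real.pi)))) := by
      refine AEStronglyMeasurable.mul ?_ ?_
      · exact ((fourier k).continuous.comp continuous_snd).aestronglyMeasurable
      · exact Complex.continuous_conj.comp_aestronglyMeasurable hu.aestronglyMeasurable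
    exact h1.integral_prod_right'
  rw [memLp_two_iff_integrable_sq_norm hm]
  have h2 := (memLp_two_iff_integrable_sq_norm hu.aestronglyMeasurable).1 hu
  rw [Measure.volume_eq_prod] at h2
  refine Integrable.mono' (h2.integral_prod_left.mul_const
    (∫ y : AddCircle (2 * Real.pi), ‖(fourier k y : ℂ)‖ ^ 2)) (hm.norm.pow 2) ?_
  filter_upwards [ae_memLp_slice hu] with x hx
  rw [Real.norm_of_nonneg (sq_nonneg _)]
  exact sq_norm_integral_mul_conj_le hx (memLp_fourier k)

/-- Completeness of the Fourier basis, stated for normalized Haar measure and transferred to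
Lebesgue measure by scaling. -/
theorem ae_eq_zero_of_fourier {f : AddCircle (2 * Real.pi) → ℂ} (hf : MemLp f 2 volume)
    (h : ∀ k : ℤ, ∫ y, fourier k y * starRingEnd ℂ (f y) = 0) : ∀ᵐ y, f y = 0 := by
  have hf' : MemLp f 2 AddCircle.haarAddCircle := memLp_haarAddCircle_iff.2 hf
  have hz : hf'.toLp f = 0 := by
    rw [← fourierBasis.repr.map_eq_zero_iff]
    ext k
    rw [fourierBasis_repr, fourierCoeff_congr_ae hf'.coeFn_toLp, fourierCoeff,
      AddCircle.integral_haarAddCircle]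
    have h1 : ∫ y, fourier (-k) y • f y = starRingEnd ℂ (∫ y, fourier k y * starRingEnd ℂ (f y)) := by
      rw [← integral_conj]
      congr 1
      ext y
      simp
    rw [h1, h k]
    simp
  have h2 : f =ᵐ[AddCircle.haarAddCircle] 0 := by
    have := hf'.coeFn_toLp
    rw [hz] at this
    exact this.symm.trans (Lp.coeFn_zero ℂ 2 _)
  rw [AddCircle.volume_eq_smul_haarAddCircle]
  exact Measure.ae_smul_measure h2 _

theorem ae_eq_zero_of_yCoeff {u : Cyl → ℂ} (hu : MemLp u 2 volume)
    (h : ∀ k, yCoeff u k =ᵐ[volume] 0) : u =ᵐ[volume] 0 := by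
  have h1 : ∀ᵐ x : ℝ, ∀ᵐ y : AddCircle (2 * Real.pi), u (x, y) = 0 := by
    -- The modes are countable, so one null set of $x$ serves all of them.
    filter_upwards [ae_all_iff.2 h, ae_memLp_slice hu] with x hx hx2
    exact ae_eq_zero_of_fourier hx2 hx
  have hm := hu.aestronglyMeasurable
  rw [Measure.volume_eq_prod] at hm ⊢
  -- Passing from slices back to the product requires a measurable zero set, hence the measurable
  -- representative.
  have hmk := hm.ae_eq_mk
  refine hmk.trans ?_
  have hs : MeasurableSet {p : Cyl | hm.mk u p = 0} :=
    hm.stronglyMeasurable_mk.measurable (measurableSet_singleton 0)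
  refine (Measure.ae_prod_iff_ae_ae hs).2 ?_
  filter_upwards [h1, Measure.ae_ae_of_ae_prod hmk] with x hx1 hx2
  filter_upwards [hx1, hx2] with y hy1 hy2
  rw [← hy2, hy1]

/-! ### Test functions of the form `φ(x) exp(iky)` -/

/-- Real test functions on the line minus the origin. -/
structure LineTest (φ : ℝ → ℝ) : Prop where
  smooth : ContDiff ℝ ∞ φ
  compact : HasCompactSupport φ
  off : tsupport φ ⊆ {x | x ≠ 0}

theorem LineTest.deriv {φ : ℝ → ℝ} (hφ : LineTest φ) : LineTest (deriv φ) where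
  smooth := (contDiff_infty_iff_deriv.1 hφ.smooth).2
  compact := hφ.compact.deriv
  off := tsupport_deriv_subset.trans hφ.off

/-- The function `φ(x) exp(iky)`. -/
def mode (φ : ℝ → ℝ) (k : ℤ) (p : Cyl) : ℂ := (φ p.1 : ℂ) * fourier k p.2

theorem isTest_mode {φ : ℝ → ℝ} (hφ : LineTest φ) (k : ℤ) : IsTest (mode φ k) := by
  have hsub : Function.support (mode φ k) ⊆ (tsupport φ) ×ˢ Set.univ := fun p hp => by
    refine ⟨subset_tsupport φ fun h => hp ?_, trivial⟩
    simp [mode, h]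
  refine ⟨?_, HasCompactSupport.of_support_subset_isCompact
    (hφ.compact.isCompact.prod isCompact_univ) hsub, fun p hp => ?_⟩
  · have h1 : (fun q : ℝ × ℝ => mode φ k (cover q)) = fun q : ℝ × ℝ =>
        (φ q.1 : ℂ) * Complex.exp (2 * Real.pi * Complex.I * k * (q.2 : ℂ) / (2 * Real.pi : ℝ)) := by
      ext q
      simp only [mode, cover, fourier_coe_apply]
    rw [h1]
    have h2 : ContDiff ℝ ∞ (fun q : ℝ × ℝ => (φ q.1 : ℂ)) :=
      Complex.ofRealCLM.contDiff.comp (hφ.smooth.comp contDiff_fst)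
    have h3 : ContDiff ℝ ∞ (fun q : ℝ × ℝ => (q.2 : ℂ)) :=
      Complex.ofRealCLM.contDiff.comp contDiff_snd
    exact h2.mul (((contDiff_const.mul h3).div_const _).cexp)
  · have hcl : IsClosed ((tsupport φ) ×ˢ (Set.univ : Set (AddCircle (2 * Real.pi)))) :=
      (isClosed_tsupport φ).prod isClosed_univ
    exact hφ.off (closure_minimal hsub hcl hp).1

theorem dx_mode {φ : ℝ → ℝ} (hφ : Differentiable ℝ φ) (k : ℤ) :
    dx (mode φ k) = mode (deriv φ) k := by
  ext p
  exact ((hφ p.1).hasDerivAt.ofReal_comp.mul_const (fourier k p.2 : ℂ)).deriv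

theorem dy_mode (φ : ℝ → ℝ) (k : ℤ) (p : Cyl) :
    dy (mode φ k) p = Complex.I * k * mode φ k p := by
  obtain ⟨⟨x, y⟩, rfl⟩ := isOpenQuotientMap_cover.surjective p
  have h1 := hasDerivAt_fourier (2 * Real.pi) k (y + 0)
  have h2 : HasDerivAt (fun t : ℝ => (fourier k ((y + t : ℝ) : AddCircle (2 * Real.pi)) : ℂ))
      _ 0 := HasDerivAt.comp_const_add y 0 h1
  have h3 := (h2.const_mul (φ x : ℂ)).deriv
  have h4 : dy (mode φ k) (cover (x, y)) = deriv (fun t : ℝ => (φ x : ℂ) *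
      (fourier k ((y + t : ℝ) : AddCircle (2 * Real.pi)) : ℂ)) 0 := rfl
  rw [h4, h3]
  have hpi : (Real.pi : ℂ) ≠ 0 := by exact_mod_cast Real.pi_ne_zero
  simp only [mode, cover, add_zero]
  push_cast
  field_simp

theorem dy_dy_mode (φ : ℝ → ℝ) (k : ℤ) (p : Cyl) :
    dy (dy (mode φ k)) p = -(k : ℂ) ^ 2 * mode φ k p := by
  have h1 : dy (mode φ k) = fun p => Complex.I * k * mode φ k p := funext (dy_mode φ k)
  rw [h1]
  have h2 : dy (fun p => Complex.I * k * mode φ k p) p = Complex.I * k * dy (mode φ k) p :=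
    deriv_const_mul_field _
  rw [h2, dy_mode]
  linear_combination (k : ℂ) ^ 2 * mode φ k p * Complex.I_sq

/-- The potential of the `k`-th Fourier mode of `1 - A`. -/
def modePotential (α : ℝ) (k : ℤ) (x : ℝ) : ℝ :=
  α / 2 * (α / 2 + 1) / x ^ 2 + (k : ℝ) ^ 2 * |x| ^ (2 * α) + 1

/-- Separation of variables: $\partial_y^2$ acts on the mode as $-k^2$, so $A-1$ reduces to a
Schrödinger operator in $x$. -/
theorem transformedLaplacian_mode (α : ℝ) {φ : ℝ → ℝ} (hφ : LineTest φ) (k : ℤ) (p : Cyl) :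
    transformedLaplacian α (mode φ k) p - mode φ k p =
      ((deriv (deriv φ) p.1 - modePotential α k p.1 * φ p.1 : ℝ) : ℂ) * fourier k p.2 := by
  rw [transformedLaplacian, dx_mode (hφ.smooth.differentiable (by simp)),
    dx_mode (hφ.deriv.smooth.differentiable (by simp)), dy_dy_mode]
  simp only [mode, modePotential]
  push_cast
  ring

theorem integrable_mul_fourier {u : Cyl → ℂ} (hu : MemLp u 2 volume) {ψ : ℝ → ℝ} {k : ℤ}
    (hψ : MemLp (fun p : Cyl => (ψ p.1 : ℂ) * fourier k p.2) 2 volume) :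
    Integrable (fun p : Cyl => ((ψ p.1 : ℂ) * fourier k p.2) * starRingEnd ℂ (u p)) := by
  have hc : MemLp (fun p => starRingEnd ℂ (u p)) 2 volume := hu.star
  exact hψ.integrable_mul hc

theorem integral_slice_mul_fourier (u : Cyl → ℂ) (ψ : ℝ → ℝ) (k : ℤ) (x : ℝ) :
    ∫ y, ((ψ x : ℂ) * fourier k y) * starRingEnd ℂ (u (x, y)) = (ψ x : ℂ) * yCoeff u k x := by
  rw [yCoeff, ← integral_const_mul]
  congr 1
  ext y
  ring

theorem integral_mul_fourier {u : Cyl → ℂ} (hu : MemLp u 2 volume) {ψ : ℝ → ℝ} {k : ℤ}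
    (hψ : MemLp (fun p : Cyl => (ψ p.1 : ℂ) * fourier k p.2) 2 volume) :
    ∫ p : Cyl, ((ψ p.1 : ℂ) * fourier k p.2) * starRingEnd ℂ (u p) = ∫ x, (ψ x : ℂ) * yCoeff u k x := by
  have hi := integrable_mul_fourier hu hψ
  rw [Measure.volume_eq_prod] at hi ⊢
  rw [integral_prod _ hi]
  simp_rw [integral_slice_mul_fourier]

theorem integrable_mul_yCoeff {u : Cyl → ℂ} (hu : MemLp u 2 volume) {ψ : ℝ → ℝ} {k : ℤ}
    (hψ : MemLp (fun p : Cyl => (ψ p.1 : ℂ) * fourier k p.2) 2 volume) :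
    Integrable (fun x => (ψ x : ℂ) * yCoeff u k x) := by
  have hi := integrable_mul_fourier hu hψ
  rw [Measure.volume_eq_prod] at hi
  simpa only [integral_slice_mul_fourier] using hi.integral_prod_left

/-- Testing against $\varphi(x)e^{iky}$ suffices: it kills each Fourier coefficient off $x=0$, a
null set. -/
theorem transformedOp_dense (α : ℝ) (u : Lp ℂ 2 (volume : Measure Cyl))
    (h : ∀ p ∈ (transformedOp α).graph, inner ℂ u p.1 = 0) : u = 0 := by
  rw [Lp.eq_zero_iff_ae_eq_zero]
  refine ae_eq_zero_of_yCoeff (Lp.memLp u) fun k => ?_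
  have hl : LocallyIntegrable (yCoeff u k) volume :=
    (memLp_yCoeff (Lp.memLp u) k).locallyIntegrable (by norm_num)
  have hop : IsOpen {x : ℝ | x ≠ 0} := isOpen_ne
  have h1 := hop.ae_eq_zero_of_integral_contDiff_smul_eq_zero (μ := volume)
    (hl.locallyIntegrableOn _) fun φ h1 h2 h3 => by
      have hφ : LineTest φ := ⟨h1, h2, h3⟩
      have ht := isTest_mode hφ k
      have := h _ (ht.mem_graph_transformedOp α)
      rw [inner_toLp_right] at this
      have h4 := integral_mul_fourier (Lp.memLp u) (ψ := φ) ht.memLp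
      rw [← this.symm.trans h4 |>.symm]
      rfl
  filter_upwards [h1, Measure.ae_ne volume (0 : ℝ)] with x hx hx0 using hx hx0

theorem HalfTest.lineTest {φ : ℝ → ℝ} (hφ : HalfTest φ) : LineTest φ :=
  ⟨hφ.smooth, hφ.compact, fun _ hx => ne_of_gt (hφ.pos hx)⟩

/-- The reflection of a test function on the half-line. -/
theorem HalfTest.lineTest_neg {φ : ℝ → ℝ} (hφ : HalfTest φ) : LineTest (fun x => φ (-x)) := by
  refine ⟨hφ.smooth.comp contDiff_neg, hφ.compact.comp_homeomorph (Homeomorph.neg ℝ), fun x hx => ?_⟩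
  have h1 : tsupport (fun x => φ (-x)) ⊆ (fun x => -x) ⁻¹' (tsupport φ) :=
    closure_minimal (fun y hy => subset_tsupport φ hy) ((isClosed_tsupport φ).preimage continuous_neg)
  have : 0 < -x := hφ.pos (h1 hx)
  exact fun h => by simp [h] at this

theorem modePotential_neg (α : ℝ) (k : ℤ) (x : ℝ) :
    modePotential α k (-x) = modePotential α k x := by
  simp [modePotential]

/-- Test functions avoid the origin, so the two half-lines decouple; evenness of `q` turns the left
one into the right one by reflection. -/
theorem ae_eq_zero_of_line {s : ℝ} (hs : 1 / 2 ≤ s) {q w : ℝ → ℝ}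
    (hq : ContinuousOn q (Set.Ioi 0)) (hqs : ∀ x, 0 < x → s * (s + 1) / x ^ 2 ≤ q x)
    (heven : ∀ x, q (-x) = q x) (hw : MemLp w 2 volume)
    (h : ∀ φ, LineTest φ → ∫ x, w x * (deriv (deriv φ) x - q x * φ x) = 0) :
    w =ᵐ[volume] 0 := by
  have h1 := ae_eq_zero_of_weak hs hq hqs (hw.mono_measure Measure.restrict_le_self)
    fun φ hφ => h φ hφ.lineTest
  have hneg := Measure.measurePreserving_neg (volume : Measure ℝ)
  have hw' : MemLp (fun x => w (-x)) 2 volume := hw.comp_measurePreserving hneg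
  have h2 := ae_eq_zero_of_weak hs hq hqs (hw'.mono_measure Measure.restrict_le_self)
    fun φ hφ => by
      have h3 := h _ hφ.lineTest_neg
      rw [← integral_neg_eq_self] at h3
      have h4 : deriv (deriv fun x => φ (-x)) = fun x => deriv (deriv φ) (-x) := by
        have e1 : (deriv fun x => φ (-x)) = fun x => -deriv φ (-x) :=
          funext fun x => deriv_comp_neg φ x
        rw [e1]
        ext x
        rw [deriv.fun_neg, deriv_comp_neg, neg_neg]
      simp only [h4, neg_neg, heven] at h3
      exact h3
  have h2' := hneg.quasiMeasurePreserving.ae h2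
  filter_upwards [h1, h2', Measure.ae_ne volume (0 : ℝ)] with x hx1 hx2 hx0
  rcases lt_or_gt_of_ne hx0 with h | h
  · simpa using hx2 (by linarith)
  · exact hx1 h

/-- This is where $\alpha\ge1$ enters: the inverse square term gives $s=\alpha/2\ge1/2$, and
$k^2|x|^{2\alpha}+1$ only increases the potential. -/
theorem transformedOp_range {α : ℝ} (hα : 1 ≤ α) (u : Lp ℂ 2 (volume : Measure Cyl))
    (h : ∀ p ∈ (transformedOp α).graph, inner ℂ u (p.2 - p.1) = 0) : u = 0 := by
  rw [Lp.eq_zero_iff_ae_eq_zero]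
  refine ae_eq_zero_of_yCoeff (Lp.memLp u) fun k => ?_
  have hm := memLp_yCoeff (Lp.memLp u) k
  have hl : LocallyIntegrable (yCoeff u k) volume := hm.locallyIntegrable (by norm_num)
  have hq : ContinuousOn (modePotential α k) (Set.Ioi 0) := by
    refine ((continuousOn_const.div (by fun_prop) fun x hx => pow_ne_zero 2 (ne_of_gt hx)).add
      (continuousOn_const.mul (ContinuousOn.rpow_const (by fun_prop) fun x hx =>
        Or.inl (abs_ne_zero.2 (ne_of_gt hx))))).add continuousOn_const
  have hqs : ∀ x, 0 < x → α / 2 * (α / 2 + 1) / x ^ 2 ≤ modePotential α k x := fun x hx => by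
    have : 0 ≤ (k : ℝ) ^ 2 * |x| ^ (2 * α) := by positivity
    simp only [modePotential]; linarith
  have hmem : ∀ φ, LineTest φ → MemLp (fun p : Cyl =>
      ((deriv (deriv φ) p.1 - modePotential α k p.1 * φ p.1 : ℝ) : ℂ) * fourier k p.2) 2 volume := by
    intro φ hφ
    have ht := isTest_mode hφ k
    have ht2 := ((isTest_transformed α ht).sub ht).memLp
    rwa [funext (transformedLaplacian_mode α hφ k)] at ht2
  have key : ∀ φ, LineTest φ →
      ∫ x, ((deriv (deriv φ) x - modePotential α k x * φ x : ℝ) : ℂ) * yCoeff u k x = 0 := by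
    intro φ hφ
    have ht := isTest_mode hφ k
    have h4 : inner ℂ u (((isTest_transformed α ht).sub ht).memLp.toLp _) = 0 :=
      h _ (ht.mem_graph_transformedOp α)
    rw [inner_toLp_right] at h4
    simp only [transformedLaplacian_mode α hφ k] at h4
    rw [← integral_mul_fourier (Lp.memLp u) (hmem φ hφ), h4]
  have hint : ∀ φ, LineTest φ → Integrable
      (fun x => ((deriv (deriv φ) x - modePotential α k x * φ x : ℝ) : ℂ) * yCoeff u k x) :=
    fun φ hφ => integrable_mul_yCoeff (Lp.memLp u) (hmem φ hφ)
  -- The potential is real, so real and imaginary parts of the coefficient solve the equation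
  -- separately.
  have hre := ae_eq_zero_of_line (by linarith : 1 / 2 ≤ α / 2) hq hqs (modePotential_neg α k) hm.re
    fun φ hφ => by
      have := congrArg Complex.re (key φ hφ)
      rw [← RCLike.re_eq_complex_re, ← integral_re (hint φ hφ)] at this
      simpa [mul_comm] using this
  have him := ae_eq_zero_of_line (by linarith : 1 / 2 ≤ α / 2) hq hqs (modePotential_neg α k) hm.im
    fun φ hφ => by
      have := congrArg Complex.im (key φ hφ)
      rw [← RCLike.im_eq_complex_im, ← integral_im (hint φ hφ)] at this
      simpa [mul_comm] using this
  filter_upwards [hre, him] with x h1 h2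
  exact Complex.ext h1 h2

/-! ### Singular elements of the domain of the adjoint -/

theorem isOpen_off : IsOpen {x : ℝ | x ≠ 0} := isOpen_ne

/-- The one-dimensional expression `φ'' - (α/2)(α/2 + 1) x⁻² φ`. -/
def radial (α : ℝ) (φ : ℝ → ℝ) (x : ℝ) : ℝ :=
  deriv (deriv φ) x - α / 2 * (α / 2 + 1) / x ^ 2 * φ x

theorem contDiffOn_deriv_off {φ : ℝ → ℝ} (hφ : ContDiffOn ℝ ∞ φ {x | x ≠ 0}) :
    ContDiffOn ℝ ∞ (deriv φ) {x | x ≠ 0} := hφ.deriv_of_isOpen isOpen_off (by simp)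

theorem smoothOff_of_contDiffOn {φ : ℝ → ℝ} (hφ : ContDiffOn ℝ ∞ φ {x | x ≠ 0}) :
    SmoothOff (fun p => (φ p.1 : ℂ)) :=
  smoothOff_ofReal (fun _ hx => hφ.contDiffAt (isOpen_off.mem_nhds hx)) fun _ _ => rfl

theorem dx_coeff_mul {φ : ℝ → ℝ} {f : Cyl → ℂ} {p : Cyl} (hφ : DifferentiableAt ℝ φ p.1)
    (hf : DifferentiableAt ℝ (fun s : ℝ => f (s, p.2)) p.1) :
    dx (fun p => (φ p.1 : ℂ) * f p) p = ((deriv φ p.1 : ℝ) : ℂ) * f p + (φ p.1 : ℂ) * dx f p :=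
  (hφ.hasDerivAt.ofReal_comp.mul hf.hasDerivAt).deriv

theorem dx_sub {f g : Cyl → ℂ} (hf : IsTest f) (hg : IsTest g) (p : Cyl) :
    dx (fun p => f p - g p) p = dx f p - dx g p :=
  ((hf.hasDerivAt_x p).sub (hg.hasDerivAt_x p)).deriv

/-- Green's formula against a function of `x` that is smooth away from `0`. -/
theorem integral_transformed_mul (α : ℝ) {φ : ℝ → ℝ} (hφ : ContDiffOn ℝ ∞ φ {x | x ≠ 0})
    {f : Cyl → ℂ} (hf : IsTest f) :
    ∫ p, transformedLaplacian α f p * (φ p.1 : ℂ) = ∫ p, f p * (radial α φ p.1 : ℂ) := by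
  have hφ' := contDiffOn_deriv_off hφ
  have hφ'' := contDiffOn_deriv_off hφ'
  have hr : ContDiffOn ℝ ∞ (radial α φ) {x | x ≠ 0} :=
    hφ''.sub ((contDiffOn_const.div (contDiffOn_id.pow 2) fun x hx => pow_ne_zero 2 hx).mul hφ)
  have t1 : IsTest (fun p => (φ p.1 : ℂ) * transformedLaplacian α f p) :=
    (isTest_transformed α hf).mul (smoothOff_of_contDiffOn hφ)
  have t2 : IsTest (fun p => (radial α φ p.1 : ℂ) * f p) := hf.mul (smoothOff_of_contDiffOn hr)
  have t3 : IsTest (fun p => (φ p.1 : ℂ) * dx f p) := hf.dx.mul (smoothOff_of_contDiffOn hφ)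
  have t4 : IsTest (fun p => ((deriv φ p.1 : ℝ) : ℂ) * f p) := hf.mul (smoothOff_of_contDiffOn hφ')
  have t5 : IsTest (fun p => (φ p.1 : ℂ) * (weight α p * dy f p)) :=
    (hf.dy.mul (smoothOff_weight α)).mul (smoothOff_of_contDiffOn hφ)
  have key : ∀ p : Cyl, (φ p.1 : ℂ) * transformedLaplacian α f p - (radial α φ p.1 : ℂ) * f p =
      dx (fun p => (φ p.1 : ℂ) * dx f p - ((deriv φ p.1 : ℝ) : ℂ) * f p) p +
        dy (fun p => (φ p.1 : ℂ) * (weight α p * dy f p)) p := fun p => by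
    have e1 : dy (fun p => (φ p.1 : ℂ) * (weight α p * dy f p)) p =
        (φ p.1 : ℂ) * (weight α p * dy (dy f) p) :=
      (dy_coeff_mul (fun x => (φ x : ℂ)) _ p).trans (congrArg _
        (dy_coeff_mul (fun x => ((|x| ^ (2 * α) : ℝ) : ℂ)) _ p))
    rw [e1, dx_sub t3 t4]
    -- At the origin `φ` need not be differentiable, but every product with a test function vanishes
    -- there.
    by_cases hp : p.1 = 0
    · have z : ∀ {g : Cyl → ℂ}, IsTest g → g p = 0 := fun {g} hg =>
        image_eq_zero_of_notMem_tsupport fun h => hg.off h hp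
      rw [z t3.dx, z t4.dx, z hf.dy.dy, z hf, z (isTest_transformed α hf)]
      simp
    · have hn := isOpen_off.mem_nhds hp
      rw [dx_coeff_mul ((hφ.contDiffAt hn).differentiableAt (by simp))
          (hf.dx.hasDerivAt_x p).differentiableAt,
        dx_coeff_mul ((hφ'.contDiffAt hn).differentiableAt (by simp))
          (hf.hasDerivAt_x p).differentiableAt]
      simp only [transformedLaplacian, radial, weight]
      push_cast
      ring
  have h := integral_sub t1.integrable t2.integrable
  simp_rw [key] at h
  rw [integral_add (t3.sub t4).dx.integrable t5.dy.integrable, (t3.sub t4).integral_dx,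
    t5.integral_dy, add_zero] at h
  simp_rw [mul_comm (transformedLaplacian α f _), mul_comm (f _)]
  linear_combination -h

/-- The circle has finite measure. -/
theorem memLp_comp_fst {φ : ℝ → ℝ} (hφ : MemLp φ 2 volume) :
    MemLp (fun p : Cyl => (φ p.1 : ℂ)) 2 volume := by
  have hm : AEStronglyMeasurable (fun p : Cyl => (φ p.1 : ℂ)) volume := by
    rw [Measure.volume_eq_prod]
    exact Complex.continuous_ofReal.comp_aestronglyMeasurable hφ.aestronglyMeasurable.comp_fst
  rw [memLp_two_iff_integrable_sq_norm hm]
  have h1 := (memLp_two_iff_integrable_sq_norm hφ.aestronglyMeasurable).1 hφ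
  have h2 : Integrable (fun p : Cyl => ‖φ p.1‖ ^ 2)
      ((volume : Measure ℝ).prod (volume : Measure (AddCircle (2 * Real.pi)))) := h1.comp_fst _
  simpa [Measure.volume_eq_prod] using h2

/-- Functions of `x` belong to the domain of the adjoint. -/
theorem inner_transformedOp_radial {α : ℝ} {φ : ℝ → ℝ} (hφ : ContDiffOn ℝ ∞ φ {x | x ≠ 0})
    (h1 : MemLp φ 2 volume) (h2 : MemLp (radial α φ) 2 volume) :
    ∀ p ∈ (transformedOp α).graph, inner ℂ ((memLp_comp_fst h1).toLp _) p.2 =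
      inner ℂ ((memLp_comp_fst h2).toLp _) p.1 := by
  intro p hp
  obtain ⟨f, e1, e2⟩ := mem_graph_transformedOp.1 hp
  rw [← e1, ← e2, inner_toLp, inner_toLp]
  simp_rw [Complex.conj_ofReal]
  exact integral_transformed_mul α hφ f.2

/-- A smooth cutoff, equal to `1` on `[-1, 1]` and to `0` off `(-2, 2)`. -/
def cutoff : ContDiffBump (0 : ℝ) := ⟨1, 2, by norm_num, by norm_num⟩

/-- The function `χ(x) x^r` for `x > 0`, extended by `0`. -/
def cutPow (r x : ℝ) : ℝ := if 0 < x then cutoff x * x ^ r else 0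

theorem cutPow_of_nonpos {r x : ℝ} (hx : x ≤ 0) : cutPow r x = 0 := if_neg (not_lt.2 hx)

theorem cutPow_of_two_le {r x : ℝ} (hx : 2 ≤ x) : cutPow r x = 0 := by
  have h : cutoff x = 0 := cutoff.zero_of_le_dist (by
    rw [Real.dist_eq, sub_zero]; exact hx.trans (le_abs_self x))
  simp [cutPow, h]

theorem cutPow_of_lt_one {r x : ℝ} (h0 : 0 < x) (h1 : x < 1) : cutPow r x = x ^ r := by
  have h : cutoff x = 1 := cutoff.one_of_mem_closedBall (by
    rw [Metric.mem_closedBall, Real.dist_eq, sub_zero, abs_of_pos h0]; exact h1.le)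
  simp [cutPow, h, h0]

theorem contDiffOn_cutPow (r : ℝ) : ContDiffOn ℝ ∞ (cutPow r) {x | x ≠ 0} := by
  intro x hx
  refine ContDiffAt.contDiffWithinAt ?_
  rcases lt_or_gt_of_ne hx with h | h
  · refine (contDiffAt_const (c := (0 : ℝ))).congr_of_eventuallyEq ?_
    filter_upwards [Iio_mem_nhds h] with y hy using cutPow_of_nonpos (le_of_lt hy)
  · have h1 : ContDiffAt ℝ ∞ (fun x => cutoff x * x ^ r) x :=
      cutoff.contDiff.contDiffAt.mul (Real.contDiffAt_rpow_const_of_ne h.ne')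
    refine h1.congr_of_eventuallyEq ?_
    filter_upwards [Ioi_mem_nhds h] with y hy using if_pos hy

theorem deriv_cutPow {r x : ℝ} (h0 : 0 < x) (h1 : x < 1) :
    deriv (cutPow r) x = r * x ^ (r - 1) := by
  have : cutPow r =ᶠ[nhds x] fun x => x ^ r := by
    filter_upwards [Ioo_mem_nhds h0 h1] with y hy using cutPow_of_lt_one hy.1 hy.2
  rw [this.deriv_eq, Real.deriv_rpow_const]

theorem deriv_deriv_cutPow {r x : ℝ} (h0 : 0 < x) (h1 : x < 1) :
    deriv (deriv (cutPow r)) x = r * ((r - 1) * x ^ (r - 2)) := by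
  have : deriv (cutPow r) =ᶠ[nhds x] fun x => r * x ^ (r - 1) := by
    filter_upwards [Ioo_mem_nhds h0 h1] with y hy using deriv_cutPow hy.1 hy.2
  rw [this.deriv_eq, deriv_const_mul_field, Real.deriv_rpow_const]
  congr 3; ring

theorem deriv_cutPow_of_two_lt {r x : ℝ} (hx : 2 < x) : deriv (cutPow r) x = 0 := by
  have : cutPow r =ᶠ[nhds x] fun _ => 0 := by
    filter_upwards [Ioi_mem_nhds hx] with y hy using cutPow_of_two_le (le_of_lt hy)
  rw [this.deriv_eq, deriv_const]

/-- The hypothesis `hr` is the indicial equation, with roots $-\alpha/2$ and $1+\alpha/2$; near $0$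
the cutoff is $1$ and the pure power is a solution. -/
theorem radial_cutPow_of_lt_one {α r x : ℝ} (hr : r * (r - 1) = α / 2 * (α / 2 + 1))
    (h0 : 0 < x) (h1 : x < 1) : radial α (cutPow r) x = 0 := by
  rw [radial, deriv_deriv_cutPow h0 h1, cutPow_of_lt_one h0 h1, ← hr]
  have : x ^ r = x ^ (r - 2) * x ^ 2 := by
    rw [← Real.rpow_natCast, ← Real.rpow_add h0]; congr 1; push_cast; ring
  rw [this]
  field_simp
  ring

theorem radial_cutPow_of_neg {α r x : ℝ} (hx : x < 0) : radial α (cutPow r) x = 0 := by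
  have h1 : ∀ y, y < 0 → deriv (cutPow r) y = 0 := fun y hy => by
    have : cutPow r =ᶠ[nhds y] fun _ => 0 := by
      filter_upwards [Iio_mem_nhds hy] with z hz using cutPow_of_nonpos (le_of_lt hz)
    rw [this.deriv_eq, deriv_const]
  have : deriv (cutPow r) =ᶠ[nhds x] fun _ => 0 := by
    filter_upwards [Iio_mem_nhds hx] with y hy using h1 y hy
  rw [radial, this.deriv_eq, deriv_const, cutPow_of_nonpos hx.le, mul_zero, sub_zero]

theorem radial_cutPow_of_two_lt {α r x : ℝ} (hx : 2 < x) : radial α (cutPow r) x = 0 := by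
  have : deriv (cutPow r) =ᶠ[nhds x] fun _ => 0 := by
    filter_upwards [Ioi_mem_nhds hx] with y hy using deriv_cutPow_of_two_lt hy
  rw [radial, this.deriv_eq, deriv_const, cutPow_of_two_le (le_of_lt hx), mul_zero, sub_zero]

theorem aestronglyMeasurable_of_contDiffOn_off {φ : ℝ → ℝ} (hφ : ContinuousOn φ {x | x ≠ 0}) :
    AEStronglyMeasurable φ volume := by
  have h1 := hφ.aestronglyMeasurable (μ := volume) isOpen_off.measurableSet
  have h2 : (volume : Measure ℝ).restrict {x | x ≠ 0} = volume :=
    Measure.restrict_eq_self_of_ae_mem (Measure.ae_ne volume (0 : ℝ))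
  rwa [h2] at h1

/-- Near $0$ the square is $x^{2r}$, integrable for $2r>-1$; for $r=-\alpha/2$ this is exactly
$\alpha<1$. -/
theorem memLp_cutPow {r : ℝ} (hr : -1 / 2 < r) : MemLp (cutPow r) 2 volume := by
  have hm := aestronglyMeasurable_of_contDiffOn_off (contDiffOn_cutPow r).continuousOn
  rw [memLp_two_iff_integrable_sq hm]
  have h1 : IntervalIntegrable (fun x : ℝ => x ^ (2 * r)) volume 0 2 :=
    intervalIntegral.intervalIntegrable_rpow' (by linarith)
  rw [intervalIntegrable_iff_integrableOn_Ioc_of_le (by norm_num)] at h1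
  refine Integrable.mono' ((integrable_indicator_iff measurableSet_Ioc).2 h1) (hm.pow 2)
    (Filter.Eventually.of_forall fun x => ?_)
  rw [Real.norm_of_nonneg (sq_nonneg _)]
  by_cases hx : x ∈ Set.Ioc (0 : ℝ) 2
  · rw [Set.indicator_of_mem hx, cutPow, if_pos hx.1, mul_pow]
    have h2 : (x ^ r) ^ 2 = x ^ (2 * r) := by
      rw [← Real.rpow_natCast, ← Real.rpow_mul hx.1.le]; congr 1; push_cast; ring
    rw [h2]
    have h3 : (cutoff x) ^ 2 ≤ 1 := pow_le_one₀ cutoff.nonneg cutoff.le_one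
    have h4 := Real.rpow_nonneg hx.1.le (2 * r)
    nlinarith
  · rw [Set.indicator_of_notMem hx]
    rcases le_or_gt x 0 with h | h
    · simp [cutPow_of_nonpos h]
    · have : 2 ≤ x := by by_contra! h'; exact hx ⟨h, h'.le⟩
      simp [cutPow_of_two_le this]

/-- Away from $x=0$, the expression lives only on the transition region $[1,2]$ of the cutoff, where
it is continuous. -/
theorem memLp_radial_cutPow {α r : ℝ} (hr : r * (r - 1) = α / 2 * (α / 2 + 1)) :
    MemLp (radial α (cutPow r)) 2 volume := by
  have hc : ContinuousOn (radial α (cutPow r)) {x | x ≠ 0} := by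
    have h0 := contDiffOn_cutPow r
    exact (contDiffOn_deriv_off (contDiffOn_deriv_off h0)).continuousOn.sub
      ((continuousOn_const.div (by fun_prop) fun x hx => pow_ne_zero 2 hx).mul h0.continuousOn)
  have hm := aestronglyMeasurable_of_contDiffOn_off hc
  rw [memLp_two_iff_integrable_sq hm]
  have h1 : IntegrableOn (fun x => radial α (cutPow r) x ^ 2) (Set.Icc 1 2) :=
    ((hc.mono fun x hx => ne_of_gt (lt_of_lt_of_le one_pos hx.1)).pow 2).integrableOn_compact
      isCompact_Icc
  refine ((integrable_indicator_iff measurableSet_Icc).2 h1).congr ?_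
  filter_upwards [Measure.ae_ne volume (0 : ℝ)] with x hx0
  by_cases hx : x ∈ Set.Icc (1 : ℝ) 2
  · rw [Set.indicator_of_mem hx]
  · rw [Set.indicator_of_notMem hx]
    have : radial α (cutPow r) x = 0 := by
      rcases lt_or_gt_of_ne hx0 with h | h
      · exact radial_cutPow_of_neg h
      · rcases lt_or_ge x 1 with h' | h'
        · exact radial_cutPow_of_lt_one hr h h'
        · exact radial_cutPow_of_two_lt (by by_contra! h''; exact hx ⟨h', h''⟩)
    rw [this]; simp

/-- The boundary term at `0` of the two singular solutions. -/
theorem integral_radial_wronskian {α : ℝ} :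
    ∫ x, (radial α (cutPow (-(α / 2))) x * cutPow (1 + α / 2) x -
      cutPow (-(α / 2)) x * radial α (cutPow (1 + α / 2)) x) = 1 + α := by
  set a := cutPow (-(α / 2)) with ha
  set b := cutPow (1 + α / 2) with hb
  have hsupp : (Function.support fun x => radial α a x * b x - a x * radial α b x) ⊆
      Set.Ioc (1 / 2) 3 := by
    intro x hx
    by_contra hx'
    refine hx ?_
    rcases le_or_gt x 0 with h | h
    · simp [ha, hb, cutPow_of_nonpos h]
    · rcases le_or_gt x (1 / 2) with h' | h'
      · simp only [ha, hb]
        rw [radial_cutPow_of_lt_one (by ring) h (by linarith),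
          radial_cutPow_of_lt_one (by ring) h (by linarith)]
        ring
      · have : 3 < x := by by_contra! h''; exact hx' ⟨h', h''⟩
        simp [ha, hb, cutPow_of_two_le (by linarith : 2 ≤ x)]
  rw [← intervalIntegral.integral_eq_integral_of_support_subset hsupp]
  have hd : ∀ r x, 0 < x → HasDerivAt (cutPow r) (deriv (cutPow r) x) x := fun r x hx =>
    (((contDiffOn_cutPow r).contDiffAt (isOpen_off.mem_nhds hx.ne')).differentiableAt
      (by simp)).hasDerivAt
  have hd' : ∀ r x, 0 < x → HasDerivAt (deriv (cutPow r)) (deriv (deriv (cutPow r)) x) x :=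
    fun r x hx => (((contDiffOn_deriv_off (contDiffOn_cutPow r)).contDiffAt
      (isOpen_off.mem_nhds hx.ne')).differentiableAt (by simp)).hasDerivAt
  have hsub : Set.uIcc (1 / 2 : ℝ) 3 ⊆ {x | x ≠ 0} := fun x hx => by
    rw [Set.uIcc_of_le (by norm_num)] at hx
    exact ne_of_gt (lt_of_lt_of_le (by norm_num) hx.1)
  have hW : ∀ x ∈ Set.uIcc (1 / 2 : ℝ) 3, HasDerivAt (fun x => deriv a x * b x - a x * deriv b x)
      (radial α a x * b x - a x * radial α b x) x := fun x hx => by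
    rw [Set.uIcc_of_le (by norm_num)] at hx
    have hx0 : 0 < x := lt_of_lt_of_le (by norm_num) hx.1
    refine (((hd' _ x hx0).mul (hd _ x hx0)).sub ((hd _ x hx0).mul (hd' _ x hx0))).congr_deriv ?_
    simp only [radial]
    ring
  have hrc : ∀ r, ContinuousOn (radial α (cutPow r)) {x | x ≠ 0} := fun r =>
    (contDiffOn_deriv_off (contDiffOn_deriv_off (contDiffOn_cutPow r))).continuousOn.sub
      ((continuousOn_const.div (by fun_prop) fun x hx => pow_ne_zero 2 hx).mul
        (contDiffOn_cutPow r).continuousOn)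
  have hcont : ContinuousOn (fun x => radial α a x * b x - a x * radial α b x)
      (Set.uIcc (1 / 2 : ℝ) 3) :=
    ((((hrc _).mul (contDiffOn_cutPow _).continuousOn)).sub
      ((contDiffOn_cutPow _).continuousOn.mul (hrc _))).mono hsub
  -- The integrand is the derivative of $a'b-ab'$, which vanishes at $3$, beyond the cutoff. At
  -- $1/2$ both functions are pure powers and the Wronskian is $-(1+\alpha)$.
  rw [intervalIntegral.integral_eq_sub_of_hasDerivAt hW hcont.intervalIntegrable]
  simp only [ha, hb]
  rw [cutPow_of_two_le (by norm_num : (2 : ℝ) ≤ 3), cutPow_of_two_le (by norm_num : (2 : ℝ) ≤ 3),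
    deriv_cutPow (x := 1 / 2) (by norm_num) (by norm_num),
    deriv_cutPow (x := 1 / 2) (by norm_num) (by norm_num),
    cutPow_of_lt_one (by norm_num) (by norm_num), cutPow_of_lt_one (by norm_num) (by norm_num)]
  have e1 : (1 / 2 : ℝ) ^ (-(α / 2) - 1) * (1 / 2 : ℝ) ^ (1 + α / 2) = 1 := by
    rw [← Real.rpow_add (by norm_num)]; ring_nf; simp
  have e2 : (1 / 2 : ℝ) ^ (-(α / 2)) * (1 / 2 : ℝ) ^ (1 + α / 2 - 1) = 1 := by
    rw [← Real.rpow_add (by norm_num)]; ring_nf; simp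
  linear_combination (α / 2) * e1 + (1 + α / 2) * e2

/-- For `α < 1` the adjoint is not symmetric. -/
theorem exists_adjoint_not_symmetric {α : ℝ} (hα : 0 < α) (h1 : α < 1) :
    ∃ u u' v v' : Lp ℂ 2 (volume : Measure Cyl),
      (∀ p ∈ (transformedOp α).graph, inner ℂ u p.2 = inner ℂ u' p.1) ∧
      (∀ p ∈ (transformedOp α).graph, inner ℂ v p.2 = inner ℂ v' p.1) ∧
      inner ℂ v u' ≠ inner ℂ v' u := by
  have m1 : MemLp (cutPow (-(α / 2))) 2 volume := memLp_cutPow (by linarith)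
  have m2 : MemLp (cutPow (1 + α / 2)) 2 volume := memLp_cutPow (by linarith)
  have m3 : MemLp (radial α (cutPow (-(α / 2)))) 2 volume := memLp_radial_cutPow (by ring)
  have m4 : MemLp (radial α (cutPow (1 + α / 2))) 2 volume := memLp_radial_cutPow (by ring)
  -- The witnesses are the two cut-off singular solutions, constant in $y$. The defect of symmetry
  -- is their Wronskian integral times the length $2\pi$ of the circle.
  refine ⟨_, _, _, _, inner_transformedOp_radial (contDiffOn_cutPow _) m1 m3,
    inner_transformedOp_radial (contDiffOn_cutPow _) m2 m4, fun h => ?_⟩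
  have i1 : Integrable fun p : Cyl => (radial α (cutPow (-(α / 2))) p.1 : ℂ) *
      starRingEnd ℂ (cutPow (1 + α / 2) p.1 : ℂ) :=
    (memLp_comp_fst m3).integrable_mul (memLp_comp_fst m2).star
  have i2 : Integrable fun p : Cyl => (cutPow (-(α / 2)) p.1 : ℂ) *
      starRingEnd ℂ (radial α (cutPow (1 + α / 2)) p.1 : ℂ) :=
    (memLp_comp_fst m1).integrable_mul (memLp_comp_fst m4).star
  rw [inner_toLp, inner_toLp, ← sub_eq_zero, ← integral_sub i1 i2] at h
  simp_rw [Complex.conj_ofReal, ← Complex.ofReal_mul, ← Complex.ofReal_sub] at h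
  rw [integral_complex_ofReal, Measure.volume_eq_prod, integral_fun_fst (f := fun x =>
    radial α (cutPow (-(α / 2))) x * cutPow (1 + α / 2) x -
      cutPow (-(α / 2)) x * radial α (cutPow (1 + α / 2)) x), integral_radial_wronskian] at h
  have hv : (volume : Measure (AddCircle (2 * Real.pi))).real Set.univ = 2 * Real.pi := by
    rw [Measure.real, AddCircle.measure_univ, ENNReal.toReal_ofReal Real.two_pi_pos.le]
  rw [hv, Complex.ofReal_eq_zero, smul_eq_mul] at h
  have : 0 < 2 * Real.pi * (1 + α) := mul_pos Real.two_pi_pos (by linarith)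
  linarith

/-! ### The Laplace-Beltrami operator in coordinates -/

/-- Writing the derivative as $(\beta/x)|x|^\beta$ covers both signs of $x$ at once. -/
theorem hasDerivAt_abs_rpow (β : ℝ) {x : ℝ} (hx : x ≠ 0) :
    HasDerivAt (fun x : ℝ => |x| ^ β) (β / x * |x| ^ β) x := by
  have h1 := (hasDerivAt_abs hx).rpow_const (p := β) (Or.inl (abs_ne_zero.2 hx))
  refine h1.congr_deriv ?_
  rw [Real.rpow_sub_one (abs_ne_zero.2 hx)]
  rcases lt_or_gt_of_ne hx with h | h
  · simp [h, abs_of_neg]; field_simp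
  · simp [h, abs_of_pos]; field_simp

theorem contDiffOn_abs_rpow (β : ℝ) : ContDiffOn ℝ ∞ (fun x : ℝ => |x| ^ β) {x | x ≠ 0} :=
  fun x hx => (contDiffAt_abs_rpow β x hx).contDiffWithinAt

theorem SmoothOff.hasDerivAt_dx {u : Cyl → ℂ} (hu : SmoothOff u) {p : Cyl} (hp : p.1 ≠ 0) :
    HasDerivAt (fun s : ℝ => dx u (s, p.2)) (dx (dx u) p) p.1 := by
  obtain ⟨⟨x, y⟩, rfl⟩ := isOpenQuotientMap_cover.surjective p
  have h1 : ContDiffOn ℝ ∞ (fun s : ℝ => u (cover (s, y))) {s | s ≠ 0} :=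
    ContDiffOn.comp (g := fun q : ℝ × ℝ => u (cover q)) (f := fun s : ℝ => ((s, y) : ℝ × ℝ)) hu
      (contDiff_id.prodMk contDiff_const).contDiffOn fun s hs => hs
  have h2 : ContDiffOn ℝ ∞ (deriv fun s : ℝ => u (cover (s, y))) {s | s ≠ 0} :=
    h1.deriv_of_isOpen isOpen_off (by simp)
  exact ((h2.contDiffAt (isOpen_off.mem_nhds hp)).differentiableAt (by simp)).hasDerivAt

theorem gradient_zero (α : ℝ) (u : Cyl → ℂ) (p : Cyl) :
    gradient fieldX (fieldY α) u p 0 = dx u p := by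
  simp [gradient, lieDeriv, fieldX, fieldY]

theorem gradient_one (α : ℝ) (u : Cyl → ℂ) (p : Cyl) :
    gradient fieldX (fieldY α) u p 1 = ((|p.1| ^ α : ℝ) : ℂ) * (((|p.1| ^ α : ℝ) : ℂ) * dy u p) := by
  simp [gradient, lieDeriv, fieldX, fieldY]

/-- The gradient is $(u_x,|x|^{2\alpha}u_y)$. Differentiating the density $|x|^{-\alpha}$ in $x$
gives the drift; it does not depend on $y$ and cancels in the other term. -/
theorem laplaceBeltrami_eq {α : ℝ} {u : Cyl → ℂ} (hu : SmoothOff u) {p : Cyl} (hp : p.1 ≠ 0) :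
    laplaceBeltrami fieldX (fieldY α) u p = dx (dx u) p
      + ((|p.1| ^ (2 * α) : ℝ) : ℂ) * dy (dy u) p - ((α / p.1 : ℝ) : ℂ) * dx u p := by
  have hpos : 0 < |p.1| := abs_pos.2 hp
  have e1 : dx (fun r => (areaDensity fieldX (fieldY α) r : ℂ) * gradient fieldX (fieldY α) u r 0) p =
      ((-α / p.1 * |p.1| ^ (-α) : ℝ) : ℂ) * dx u p + ((|p.1| ^ (-α) : ℝ) : ℂ) * dx (dx u) p := by
    have h1 := (hasDerivAt_abs_rpow (-α) hp).ofReal_comp.mul (hu.hasDerivAt_dx hp)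
    refine Filter.EventuallyEq.deriv_eq ?_ |>.trans h1.deriv
    filter_upwards [isOpen_off.mem_nhds hp] with s hs
    rw [gradient_zero, areaDensity_eq α (p := (s, p.2)) hs]
    rfl
  have e2 : dy (fun r => (areaDensity fieldX (fieldY α) r : ℂ) * gradient fieldX (fieldY α) u r 1) p =
      ((|p.1| ^ (-α) * (|p.1| ^ α * |p.1| ^ α) : ℝ) : ℂ) * dy (dy u) p := by
    have h1 : (fun t : ℝ => (areaDensity fieldX (fieldY α)
        (p.1, p.2 + (t : AddCircle (2 * Real.pi))) : ℂ) *
        gradient fieldX (fieldY α) u (p.1, p.2 + (t : AddCircle (2 * Real.pi))) 1) = fun t : ℝ =>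
        ((|p.1| ^ (-α) * (|p.1| ^ α * |p.1| ^ α) : ℝ) : ℂ) *
          dy u (p.1, p.2 + (t : AddCircle (2 * Real.pi))) := by
      ext t
      rw [gradient_one, areaDensity_eq α (p := (p.1, p.2 + (t : AddCircle (2 * Real.pi)))) hp]
      push_cast; ring
    rw [dy, h1]
    exact deriv_const_mul_field _
  rw [laplaceBeltrami, divergence, e1, e2, areaDensity_eq α hp]
  have h0 : |p.1| ^ (-α) ≠ 0 := (Real.rpow_pos_of_pos hpos _).ne'
  have h2 : |p.1| ^ (2 * α) = |p.1| ^ α * |p.1| ^ α := by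
    rw [← Real.rpow_add hpos]; congr 1; ring
  have h0' : ((|p.1| ^ (-α) : ℝ) : ℂ) ≠ 0 := Complex.ofReal_ne_zero.2 h0
  have hp' : (p.1 : ℂ) ≠ 0 := Complex.ofReal_ne_zero.2 hp
  rw [h2]
  push_cast
  field_simp
  ring

/-! ### Conjugation by `|x| ^ (α / 2)` -/

/-- The multiplier `|x| ^ β`. -/
def absPow (β : ℝ) (p : Cyl) : ℂ := ((|p.1| ^ β : ℝ) : ℂ)

theorem smoothOff_absPow (β : ℝ) : SmoothOff (absPow β) :=
  smoothOff_of_contDiffOn (contDiffOn_abs_rpow β)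

theorem IsTest.eq_zero {f : Cyl → ℂ} (hf : IsTest f) {p : Cyl} (hp : p.1 = 0) : f p = 0 :=
  image_eq_zero_of_notMem_tsupport fun h => hf.off h hp

theorem isTest_laplaceBeltrami (α : ℝ) {f : Cyl → ℂ} (hf : IsTest f) :
    IsTest (laplaceBeltrami fieldX (fieldY α) f) := (laplaceBeltramiLin α ⟨f, hf⟩).2

theorem dx_absPow_mul (β : ℝ) {f : Cyl → ℂ} (hf : IsTest f) :
    dx (fun p => absPow β p * f p) =
      fun p => absPow β p * (((β / p.1 : ℝ) : ℂ) * f p + dx f p) := by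
  ext p
  by_cases hp : p.1 = 0
  · rw [(hf.mul (smoothOff_absPow β)).dx.eq_zero hp, hf.eq_zero hp, hf.dx.eq_zero hp]
    simp
  · refine ((hasDerivAt_abs_rpow β hp).ofReal_comp.mul (hf.hasDerivAt_x p)).deriv.trans ?_
    simp only [absPow]
    push_cast
    ring

/-- The exponent $\alpha/2$ is the one for which $2(\alpha/2)/x$ cancels the drift $\alpha/x$. What
remains at order zero is
$\frac\alpha2(\frac\alpha2-1)-\alpha\cdot\frac\alpha2=-\frac\alpha2(\frac\alpha2+1)$, over $x^2$. -/
theorem laplaceBeltrami_absPow_mul (α : ℝ) {f : Cyl → ℂ} (hf : IsTest f) :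
    laplaceBeltrami fieldX (fieldY α) (fun p => absPow (α / 2) p * f p) =
      fun p => absPow (α / 2) p * transformedLaplacian α f p := by
  ext p
  have hu := hf.mul (smoothOff_absPow (α / 2))
  by_cases hp : p.1 = 0
  · rw [(isTest_laplaceBeltrami α hu).eq_zero hp, (isTest_transformed α hf).eq_zero hp, mul_zero]
  have hinv : SmoothOff fun p : Cyl => ((α / 2 / p.1 : ℝ) : ℂ) :=
    smoothOff_of_contDiffOn (φ := fun x => α / 2 / x) (contDiffOn_const.div contDiffOn_id
      fun x hx => hx)
  have t1 : IsTest fun p => ((α / 2 / p.1 : ℝ) : ℂ) * f p := hf.mul hinv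
  have e2 : dx (fun p => ((α / 2 / p.1 : ℝ) : ℂ) * f p + dx f p) p =
      ((-(α / 2) / p.1 ^ 2 : ℝ) : ℂ) * f p + ((α / 2 / p.1 : ℝ) : ℂ) * dx f p + dx (dx f) p := by
    have h1 : HasDerivAt (fun x : ℝ => α / 2 / x) (-(α / 2) / p.1 ^ 2) p.1 := by
      have := (hasDerivAt_inv hp).const_mul (α / 2)
      refine (this.congr_deriv (by ring)).congr_of_eventuallyEq
        (Filter.Eventually.of_forall fun x => div_eq_mul_inv _ _)
    exact ((h1.ofReal_comp.mul (hf.hasDerivAt_x p)).add (hf.dx.hasDerivAt_x p)).deriv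
  have e3 : dy (dy fun p => absPow (α / 2) p * f p) p = absPow (α / 2) p * dy (dy f) p := by
    have : (dy fun p => absPow (α / 2) p * f p) = fun p => absPow (α / 2) p * dy f p :=
      funext fun p => dy_coeff_mul (fun x => ((|x| ^ (α / 2) : ℝ) : ℂ)) f p
    rw [this]
    exact dy_coeff_mul (fun x => ((|x| ^ (α / 2) : ℝ) : ℂ)) (dy f) p
  rw [laplaceBeltrami_eq hu.smoothOff hp, dx_absPow_mul _ hf, dx_absPow_mul _ (t1.add hf.dx)]
  dsimp only
  rw [e2, e3]
  simp only [transformedLaplacian]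
  have hp' : (p.1 : ℂ) ≠ 0 := Complex.ofReal_ne_zero.2 hp
  push_cast
  field_simp
  ring

theorem absPow_mul_neg {β : ℝ} {p : Cyl} (hp : p.1 ≠ 0) : absPow β p * absPow (-β) p = 1 := by
  rw [absPow, absPow, ← Complex.ofReal_mul, ← Real.rpow_add (abs_pos.2 hp)]
  simp

theorem ae_off : ∀ᵐ p : Cyl, p.1 ≠ 0 :=
  (Measure.quasiMeasurePreserving_fst (μ := (volume : Measure ℝ))
    (ν := (volume : Measure (AddCircle (2 * Real.pi))))).ae (Measure.ae_ne volume (0 : ℝ))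

theorem grushinArea_ac (α : ℝ) : grushinArea α ≪ volume := withDensity_absolutelyContinuous _ _

theorem measurable_absPow (β : ℝ) : Measurable (absPow β) := by
  unfold absPow; fun_prop

/-- Off the null set $x=0$, the squared multiplier $|x|^\alpha$ cancels the density. -/
theorem lintegral_grushinArea (α : ℝ) (v : Cyl → ℂ) :
    ∫⁻ p, ‖absPow (α / 2) p * v p‖ₑ ^ (2 : ℝ) ∂grushinArea α = ∫⁻ p, ‖v p‖ₑ ^ (2 : ℝ) := by
  rw [grushinArea, areaMeasure, lintegral_withDensity_eq_lintegral_mul_non_measurable _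
    (measurable_areaDensity α).ennreal_ofReal (Filter.Eventually.of_forall fun _ => by simp)]
  refine lintegral_congr_ae ?_
  filter_upwards [ae_off] with p hp
  have hpos : 0 < |p.1| := abs_pos.2 hp
  rw [Pi.mul_apply, areaDensity_eq α hp, enorm_mul, ENNReal.mul_rpow_of_nonneg _ _ (by norm_num),
    ← mul_assoc]
  have h1 : ‖absPow (α / 2) p‖ₑ = ENNReal.ofReal (|p.1| ^ (α / 2)) := by
    rw [← ofReal_norm, absPow, Complex.norm_real,
      Real.norm_of_nonneg (Real.rpow_nonneg hpos.le _)]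
  rw [h1, ENNReal.ofReal_rpow_of_nonneg (Real.rpow_nonneg hpos.le _) (by norm_num),
    ← ENNReal.ofReal_mul (Real.rpow_nonneg hpos.le _), ← Real.rpow_mul hpos.le,
    ← Real.rpow_add hpos]
  simp

theorem eLpNorm_absPow_mul (α : ℝ) (v : Cyl → ℂ) :
    eLpNorm (fun p => absPow (α / 2) p * v p) 2 (grushinArea α) = eLpNorm v 2 volume := by
  rw [eLpNorm_eq_lintegral_rpow_enorm_toReal (by norm_num) (by norm_num),
    eLpNorm_eq_lintegral_rpow_enorm_toReal (by norm_num) (by norm_num)]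
  simp only [ENNReal.toReal_ofNat]
  rw [lintegral_grushinArea]

theorem memLp_absPow_mul {α : ℝ} {v : Cyl → ℂ} (hv : MemLp v 2 volume) :
    MemLp (fun p => absPow (α / 2) p * v p) 2 (grushinArea α) :=
  ⟨(measurable_absPow _).aestronglyMeasurable.mul (hv.1.mono_ac (grushinArea_ac α)), by
    rw [eLpNorm_absPow_mul]; exact hv.2⟩

theorem memLp_absPow_neg_mul {α : ℝ} {v : Cyl → ℂ} (hv : MemLp v 2 (grushinArea α)) :
    MemLp (fun p => absPow (-(α / 2)) p * v p) 2 volume := by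
  refine ⟨(measurable_absPow _).aestronglyMeasurable.mul (hv.1.mono_ac (volume_ac α)), ?_⟩
  rw [← eLpNorm_absPow_mul α]
  refine (eLpNorm_congr_ae ?_).trans_lt hv.2
  filter_upwards [(grushinArea_ac α).ae_le ae_off] with p hp
  rw [← mul_assoc, absPow_mul_neg hp, one_mul]

/-- Multiplication by `|x| ^ (α / 2)` as an isometry. -/
def conjugationIsometry (α : ℝ) : Lp ℂ 2 (volume : Measure Cyl) →ₗᵢ[ℂ] Lp ℂ 2 (grushinArea α) where
  toFun v := (memLp_absPow_mul (Lp.memLp v)).toLp _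
  map_add' v w := by
    rw [← MemLp.toLp_add, MemLp.toLp_eq_toLp_iff]
    filter_upwards [(grushinArea_ac α).ae_le (Lp.coeFn_add v w)] with p hp
    simp only [hp, Pi.add_apply, mul_add]
  map_smul' c v := by
    rw [RingHom.id_apply, ← MemLp.toLp_const_smul, MemLp.toLp_eq_toLp_iff]
    filter_upwards [(grushinArea_ac α).ae_le (Lp.coeFn_smul c v)] with p hp
    simp only [hp, Pi.smul_apply, smul_eq_mul]
    ring
  norm_map' v := by
    change ‖(memLp_absPow_mul (Lp.memLp v)).toLp _‖ = ‖v‖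
    rw [Lp.norm_toLp, eLpNorm_absPow_mul, Lp.norm_def]

theorem conjugationIsometry_coeFn (α : ℝ) (v : Lp ℂ 2 (volume : Measure Cyl)) :
    conjugationIsometry α v =ᵐ[grushinArea α] fun p => absPow (α / 2) p * v p :=
  (memLp_absPow_mul (Lp.memLp v)).coeFn_toLp

theorem conjugationIsometry_surjective (α : ℝ) : Function.Surjective (conjugationIsometry α) := by
  intro g
  refine ⟨(memLp_absPow_neg_mul (Lp.memLp g)).toLp _, Lp.ext ?_⟩
  filter_upwards [conjugationIsometry_coeFn α ((memLp_absPow_neg_mul (Lp.memLp g)).toLp _),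
    (grushinArea_ac α).ae_le (memLp_absPow_neg_mul (Lp.memLp g)).coeFn_toLp,
    (grushinArea_ac α).ae_le ae_off] with p h1 h2 h3
  rw [h1, h2, ← mul_assoc, absPow_mul_neg h3, one_mul]

/-- Multiplication by `|x| ^ (α / 2)` as a unitary map. -/
def conjugation (α : ℝ) : Lp ℂ 2 (volume : Measure Cyl) ≃ₗᵢ[ℂ] Lp ℂ 2 (grushinArea α) :=
  LinearIsometryEquiv.ofSurjective (conjugationIsometry α) (conjugationIsometry_surjective α)

theorem conjugation_coeFn (α : ℝ) (v : Lp ℂ 2 (volume : Measure Cyl)) :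
    conjugation α v =ᵐ[grushinArea α] fun p => absPow (α / 2) p * v p :=
  conjugationIsometry_coeFn α v

theorem IsTest.memLp_grushinArea {f : Cyl → ℂ} (hf : IsTest f) (α : ℝ) :
    MemLp f 2 (grushinArea α) := memLp_area α ⟨f, hf⟩

theorem conjugation_toLp {α : ℝ} {f g : Cyl → ℂ} (hf : IsTest f) (hg : IsTest g)
    (h : ∀ p, g p = absPow (α / 2) p * f p) :
    conjugation α (hf.memLp.toLp f) = (hg.memLp_grushinArea α).toLp g := by
  refine Lp.ext ?_
  filter_upwards [conjugation_coeFn α (hf.memLp.toLp f), (hg.memLp_grushinArea α).coeFn_toLp,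
    (grushinArea_ac α).ae_le hf.memLp.coeFn_toLp] with p h1 h2 h3
  rw [h1, h2, h3, h]

theorem mem_graph_laplaceBeltramiOp {α : ℝ} {p : Lp ℂ 2 (grushinArea α) × Lp ℂ 2 (grushinArea α)} :
    p ∈ (laplaceBeltramiOp α).graph ↔ ∃ f : testSpace, (f.2.memLp_grushinArea α).toLp f = p.1 ∧
      ((isTest_laplaceBeltrami α f.2).memLp_grushinArea α).toLp
        (laplaceBeltrami fieldX (fieldY α) f) = p.2 :=
  mem_graph_testOperator

/-- The unitary equivalence of the two operators. -/
theorem mem_graph_conjugation_iff (α : ℝ) (v w : Lp ℂ 2 (volume : Measure Cyl)) :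
    (v, w) ∈ (transformedOp α).graph ↔
      (conjugation α v, conjugation α w) ∈ (laplaceBeltramiOp α).graph := by
  constructor
  · intro h
    obtain ⟨f, h1, h2⟩ := mem_graph_transformedOp.1 h
    dsimp only at h1 h2
    have hg := f.2.mul (smoothOff_absPow (α / 2))
    refine mem_graph_laplaceBeltramiOp.2 ⟨⟨_, hg⟩, ?_, ?_⟩
    · rw [← h1]; exact (conjugation_toLp f.2 hg fun _ => rfl).symm
    · rw [← h2]
      exact (conjugation_toLp (isTest_transformed α f.2) (isTest_laplaceBeltrami α hg)
        fun p => congrFun (laplaceBeltrami_absPow_mul α f.2) p).symm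
  · intro h
    obtain ⟨⟨g, hg⟩, h1, h2⟩ := mem_graph_laplaceBeltramiOp.1 h
    dsimp only at h1 h2
    -- Dividing by the multiplier keeps test functions, since it is smooth and nonzero off the
    -- origin; this gives surjectivity onto the second domain.
    have hf := hg.mul (smoothOff_absPow (-(α / 2)))
    have hgf : g = fun p => absPow (α / 2) p * (absPow (-(α / 2)) p * g p) := by
      ext p
      by_cases hp : p.1 = 0
      · rw [hg.eq_zero hp]; simp
      · rw [← mul_assoc, absPow_mul_neg hp, one_mul]
    have hL : ∀ p, laplaceBeltrami fieldX (fieldY α) g p = absPow (α / 2) p *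
        transformedLaplacian α (fun p => absPow (-(α / 2)) p * g p) p := fun p => by
      rw [← congrFun (laplaceBeltrami_absPow_mul α hf) p, ← hgf]
    refine mem_graph_transformedOp.2 ⟨⟨_, hf⟩, (conjugation α).injective ?_,
      (conjugation α).injective ?_⟩
    · exact (conjugation_toLp hf hg (congrFun hgf)).trans h1
    · exact (conjugation_toLp (isTest_transformed α hf) (isTest_laplaceBeltrami α hg) hL).trans h2

/-! ### Essential self-adjointness -/

theorem transformedOp_essentiallySelfAdjoint {α : ℝ} (hα : 1 ≤ α) :
    IsEssentiallySelfAdjoint (transformedOp α) :=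
  .of_graph (transformedOp_dense α) (transformedOp_symmetric α)
    (transformedOp_nonpos (by linarith)) (transformedOp_range hα)

theorem transformedOp_not_essentiallySelfAdjoint {α : ℝ} (hα : 0 < α) (h1 : α < 1) :
    ¬ IsEssentiallySelfAdjoint (transformedOp α) := by
  obtain ⟨u, u', v, v', hu, hv, hne⟩ := exists_adjoint_not_symmetric hα h1
  exact fun h => hne (h.inner_eq_of_adjoint hu hv)

/-- Every point of the graph of `Δ` comes from the graph of the transformed operator. -/
theorem forall_mem_graph_laplaceBeltramiOp {α : ℝ}
    {P : Lp ℂ 2 (grushinArea α) × Lp ℂ 2 (grushinArea α) → Prop}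
    (h : ∀ p ∈ (transformedOp α).graph, P (conjugation α p.1, conjugation α p.2)) :
    ∀ p ∈ (laplaceBeltramiOp α).graph, P p := by
  rintro ⟨a, b⟩ hp
  obtain ⟨v, rfl⟩ := (conjugation α).surjective a
  obtain ⟨w, rfl⟩ := (conjugation α).surjective b
  exact h (v, w) ((mem_graph_conjugation_iff α v w).2 hp)

/-- Each hypothesis of the graph criterion involves only inner products of graph elements, so all
four cross the unitary equivalence. -/
theorem laplaceBeltramiOp_essentiallySelfAdjoint {α : ℝ} (hα : 1 ≤ α) :
    IsEssentiallySelfAdjoint (laplaceBeltramiOp α) := by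
  have hmem : ∀ p ∈ (transformedOp α).graph,
      (conjugation α p.1, conjugation α p.2) ∈ (laplaceBeltramiOp α).graph :=
    fun p hp => (mem_graph_conjugation_iff α p.1 p.2).1 hp
  refine .of_graph (fun u h => ?_) ?_ ?_ (fun u h => ?_)
  · obtain ⟨u, rfl⟩ := (conjugation α).surjective u
    rw [transformedOp_dense α u fun p hp => ?_, map_zero]
    simpa using h _ (hmem p hp)
  · refine forall_mem_graph_laplaceBeltramiOp fun p hp =>
      forall_mem_graph_laplaceBeltramiOp fun q hq => ?_
    simpa using transformedOp_symmetric α p hp q hq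
  · refine forall_mem_graph_laplaceBeltramiOp fun p hp => ?_
    simpa using transformedOp_nonpos (by linarith) p hp
  · obtain ⟨u, rfl⟩ := (conjugation α).surjective u
    rw [transformedOp_range hα u fun p hp => ?_, map_zero]
    have := h _ (hmem p hp)
    dsimp only at this
    rwa [← map_sub, LinearIsometryEquiv.inner_map_map] at this

theorem laplaceBeltramiOp_not_essentiallySelfAdjoint {α : ℝ} (hα : 0 < α) (h1 : α < 1) :
    ¬ IsEssentiallySelfAdjoint (laplaceBeltramiOp α) := by
  obtain ⟨u, u', v, v', hu, hv, hne⟩ := exists_adjoint_not_symmetric hα h1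
  intro h
  have := h.inner_eq_of_adjoint (u := conjugation α u) (u' := conjugation α u')
    (v := conjugation α v) (v' := conjugation α v')
    (forall_mem_graph_laplaceBeltramiOp fun p hp => by simpa using hu p hp)
    (forall_mem_graph_laplaceBeltramiOp fun p hp => by simpa using hv p hp)
  exact hne (by simpa using this)

end AlphaGrushin

end

theorem mainTheorem7 (α : ℝ) (hα : 0 < α) :
    (∀ u : AlphaGrushin.Cyl → ℂ, AlphaGrushin.SmoothOff u →
      ∀ p : AlphaGrushin.Cyl, p.1 ≠ 0 →
        AlphaGrushin.laplaceBeltrami AlphaGrushin.fieldX (AlphaGrushin.fieldY α) u p =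
          AlphaGrushin.dx (AlphaGrushin.dx u) p
            + ((|p.1| ^ (2 * α) : ℝ) : ℂ) * AlphaGrushin.dy (AlphaGrushin.dy u) p
            - ((α / p.1 : ℝ) : ℂ) * AlphaGrushin.dx u p) ∧
    (∃ U : Lp ℂ 2 (volume : Measure AlphaGrushin.Cyl) ≃ₗᵢ[ℂ] Lp ℂ 2 (AlphaGrushin.grushinArea α),
      (∀ v, (U v : AlphaGrushin.Cyl → ℂ) =ᵐ[AlphaGrushin.grushinArea α]
        fun p => ((|p.1| ^ (α / 2) : ℝ) : ℂ) * (v : AlphaGrushin.Cyl → ℂ) p) ∧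
      ∀ v w, (v, w) ∈ (AlphaGrushin.transformedOp α).graph ↔
        (U v, U w) ∈ (AlphaGrushin.laplaceBeltramiOp α).graph) ∧
    (AlphaGrushin.IsEssentiallySelfAdjoint (AlphaGrushin.transformedOp α) ↔ 1 ≤ α) ∧
    (AlphaGrushin.IsEssentiallySelfAdjoint (AlphaGrushin.laplaceBeltramiOp α) ↔ 1 ≤ α) ∧
    (α < 1 → ¬ AlphaGrushin.IsEssentiallySelfAdjoint (AlphaGrushin.transformedOp α) ∧
      ¬ AlphaGrushin.IsEssentiallySelfAdjoint (AlphaGrushin.laplaceBeltramiOp α)) := by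
  have hT : AlphaGrushin.IsEssentiallySelfAdjoint (AlphaGrushin.transformedOp α) ↔ 1 ≤ α :=
    ⟨fun h => not_lt.1 fun h1 =>
      AlphaGrushin.transformedOp_not_essentiallySelfAdjoint hα h1 h,
      AlphaGrushin.transformedOp_essentiallySelfAdjoint⟩
  have hL : AlphaGrushin.IsEssentiallySelfAdjoint (AlphaGrushin.laplaceBeltramiOp α) ↔ 1 ≤ α :=
    ⟨fun h => not_lt.1 fun h1 =>
      AlphaGrushin.laplaceBeltramiOp_not_essentiallySelfAdjoint hα h1 h,
      AlphaGrushin.laplaceBeltramiOp_essentiallySelfAdjoint⟩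
  exact ⟨fun u hu p hp => AlphaGrushin.laplaceBeltrami_eq hu hp,
    ⟨AlphaGrushin.conjugation α, AlphaGrushin.conjugation_coeFn α,
      AlphaGrushin.mem_graph_conjugation_iff α⟩, hT, hL,
    fun h1 => ⟨fun h => not_le.2 h1 (hT.1 h), fun h => not_le.2 h1 (hL.1 h)⟩⟩
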